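/- All Banach spaces are real. Let $X$ and $X_n$ ($n\in\mathbb N$) be Banach spaces with $X=\sum_{n=1}^{\infty}\oplus X_n$ a Schauder decomposition; that is, each $X_n$ is (isomorphic to, and identified with) a closed subspace of $X$, and every $x\in X$ has a unique expansion $x=\sum_{n=1}^{\infty}x_n$ with $x_n\in X_n$, the series converging in norm. Let $P_n:X\to X_n$, $P_nx=x_n$, be the associated (automatically bounded) projections. A bounded linear operator is called Dunford–Pettis if it maps weakly compact sets to norm compact sets. A bounded linear operator $S:L^1(0,1)\to Z$ into a Banach space $Z$ is called representable if there is $g\in L^\infty((0,1);Z)$ such that $Sf=\int_0^1 f(t)\,g(t)\,dt$ (Bochner integral) for every $f\in L^1(0,1)$. **Proposition 1.2.** Let $T:L^1(0,1)\to X$ be a bounded linear operator which is not Dunford–Pettis, while $P_nT:L^1(0,1)\to X_n$ is Dunford–Pettis for every $n\in\mathbb N$. Then there exists a bounded linear operator $D:L^1(0,1)\to L^1(0,1)$ such that $TD:L^1(0,1)\to X$ is not representable and $P_nTD:L^1(0,1)\to X_n$ is representable for every $n\in\mathbb N$. -/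

import Mathlib

open MeasureTheory Filter Topology
open scoped ENNReal

noncomputable section

/-- Lebesgue measure on the open unit interval `(0,1)`. -/
abbrev unitMeasure : Measure ℝ := volume.restrict (Set.Ioo (0 : ℝ) 1)

/-- The real Banach space `L¹(0,1)`. -/
abbrev L1 : Type := Lp ℝ 1 unitMeasure

/-- A bounded operator is Dunford-Pettis if it maps weakly compact sets to norm compact sets. -/
def IsDunfordPettis {E F : Type*} [NormedAddCommGroup E] [NormedSpace ℝ E]
    [NormedAddCommGroup F] [NormedSpace ℝ F] (T : E →L[ℝ] F) : Prop :=
  ∀ K : Set E, IsCompact (toWeakSpace ℝ E '' K) → IsCompact (T '' K)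

/-- An operator `T : L¹(0,1) → F` is representable if there is `g ∈ L^∞((0,1); F)` with
`T f = ∫ f g` (Bochner integral) for every `f ∈ L¹(0,1)`. The integrand is integrable for all
such `f` and `g`. -/
def IsRepresentable {F : Type*} [NormedAddCommGroup F] [NormedSpace ℝ F]
    (T : L1 →L[ℝ] F) : Prop :=
  ∃ g : Lp F ∞ unitMeasure, ∀ f : L1, T f = ∫ t, f t • g t ∂unitMeasure

section Decomposition

variable {X : Type*} [NormedAddCommGroup X] [NormedSpace ℝ X]
  {Y : ℕ → Type*} [∀ n, NormedAddCommGroup (Y n)] [∀ n, NormedSpace ℝ (Y n)]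

/-- `X = ∑ ⊕ Y n` is a Schauder decomposition: each `Y n` is identified, through `J n`, with a
closed subspace of `X`, and every `x : X` has exactly one expansion `x = ∑ J n (y n)` with
`y n ∈ Y n`, the series being convergent in norm. When the `Y n` are given as closed subspaces
of `X`, the `J n` are the inclusions. -/
structure IsSchauderDecomposition (J : ∀ n, Y n →L[ℝ] X) : Prop where
  isClosedEmbedding : ∀ n, IsClosedEmbedding (J n)
  existsUnique : ∀ x : X, ∃! y : ∀ n, Y n,
    Tendsto (fun N => ∑ n ∈ Finset.range N, J n (y n)) atTop (𝓝 x)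

namespace IsSchauderDecomposition

variable {J : ∀ n, Y n →L[ℝ] X}

/-- The coordinates of `x` in a Schauder decomposition. -/
def coord (h : IsSchauderDecomposition J) (x : X) : ∀ n, Y n :=
  (h.existsUnique x).choose

theorem tendsto_coord (h : IsSchauderDecomposition J) (x : X) :
    Tendsto (fun N => ∑ n ∈ Finset.range N, J n (h.coord x n)) atTop (𝓝 x) :=
  (h.existsUnique x).choose_spec.1

theorem coord_eq (h : IsSchauderDecomposition J) {x : X} {y : ∀ n, Y n}
    (hy : Tendsto (fun N => ∑ n ∈ Finset.range N, J n (y n)) atTop (𝓝 x)) :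
    h.coord x = y :=
  ((h.existsUnique x).choose_spec.2 y hy).symm

theorem coord_add (h : IsSchauderDecomposition J) (x y : X) :
    h.coord (x + y) = h.coord x + h.coord y := by
  apply h.coord_eq
  simpa [Finset.sum_add_distrib] using (h.tendsto_coord x).add (h.tendsto_coord y)

theorem coord_smul (h : IsSchauderDecomposition J) (c : ℝ) (x : X) :
    h.coord (c • x) = c • h.coord x := by
  apply h.coord_eq
  simpa [Finset.smul_sum] using (h.tendsto_coord x).const_smul c

/-- The space of sequences of partial sums of expansions, as a space of continuous functions on
the one-point compactification of `ℕ`. -/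
def sumSpace (J : ∀ n, Y n →L[ℝ] X) : Submodule ℝ C(OnePoint ℕ, X) where
  carrier := {s | s ((0 : ℕ) : OnePoint ℕ) = 0 ∧
    ∀ n : ℕ, s ((n + 1 : ℕ) : OnePoint ℕ) - s (n : OnePoint ℕ) ∈ Set.range (J n)}
  zero_mem' := ⟨rfl, fun n => ⟨0, by simp⟩⟩
  add_mem' := by
    rintro s t ⟨hs, hs'⟩ ⟨ht, ht'⟩
    refine ⟨by simp [hs, ht], fun n => ?_⟩
    obtain ⟨a, ha⟩ := hs' n
    obtain ⟨b, hb⟩ := ht' n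
    refine ⟨a + b, ?_⟩
    rw [map_add, ha, hb, ContinuousMap.add_apply, ContinuousMap.add_apply]
    abel
  smul_mem' := by
    rintro c s ⟨hs, hs'⟩
    refine ⟨by simp [hs], fun n => ?_⟩
    obtain ⟨a, ha⟩ := hs' n
    exact ⟨c • a, by rw [map_smul, ha, smul_sub]; rfl⟩

theorem isClosed_sumSpace (h : IsSchauderDecomposition J) :
    IsClosed (sumSpace J : Set C(OnePoint ℕ, X)) := by
  have : (sumSpace J : Set C(OnePoint ℕ, X)) =
      {s | s ((0 : ℕ) : OnePoint ℕ) = 0} ∩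
      ⋂ n : ℕ, (fun s : C(OnePoint ℕ, X) =>
        s ((n + 1 : ℕ) : OnePoint ℕ) - s (n : OnePoint ℕ)) ⁻¹' Set.range (J n) := by
    ext s
    simp [sumSpace]
  rw [this]
  refine (isClosed_eq (continuous_eval_const _) continuous_const).inter
    (isClosed_iInter fun n => (h.isClosedEmbedding n).isClosed_range.preimage ?_)
  exact (continuous_eval_const _).sub (continuous_eval_const _)

/-- The map sending a sequence of partial sums to its limit. -/
def limMap (J : ∀ n, Y n →L[ℝ] X) : sumSpace J →L[ℝ] X where
  toFun s := s.1 OnePoint.infty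
  map_add' _ _ := rfl
  map_smul' _ _ := rfl
  cont := (continuous_eval_const _).comp continuous_subtype_val

theorem eq_sum_coord (h : IsSchauderDecomposition J) (s : sumSpace J) (N : ℕ) :
    s.1 (N : OnePoint ℕ) = ∑ n ∈ Finset.range N, J n (h.coord (limMap J s) n) := by
  choose y hy using s.2.2
  have hsum : ∀ M : ℕ, ∑ n ∈ Finset.range M, J n (y n) = s.1 (M : OnePoint ℕ) := by
    intro M
    induction M with
    | zero => simpa using s.2.1.symm
    | succ k ih => rw [Finset.sum_range_succ, ih, hy]; abel
  have hlim : Tendsto (fun M : ℕ => s.1 (M : OnePoint ℕ)) atTop (𝓝 (limMap J s)) := by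
    have h1 := (s.1.continuous.tendsto OnePoint.infty)
    have h2 : Tendsto (fun M : ℕ => (M : OnePoint ℕ)) atTop (𝓝 OnePoint.infty) := by
      have := OnePoint.tendsto_coe_infty (X := ℕ)
      rwa [Filter.coclosedCompact_eq_cocompact, cocompact_eq_atTop] at this
    exact h1.comp h2
  rw [h.coord_eq (y := y) (by simpa only [hsum] using hlim), hsum]

theorem limMap_injective (h : IsSchauderDecomposition J) : Function.Injective (limMap J) := by
  intro s t hst
  ext p
  induction p using OnePoint.rec with
  | infty => exact hst
  | coe N => rw [h.eq_sum_coord s N, h.eq_sum_coord t N, hst]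

theorem limMap_surjective (h : IsSchauderDecomposition J) : Function.Surjective (limMap J) := by
  intro x
  refine ⟨⟨OnePoint.continuousMapMkNat
    (fun N => ∑ n ∈ Finset.range N, J n (h.coord x n)) x (h.tendsto_coord x), ?_, ?_⟩, ?_⟩
  · exact Finset.sum_range_zero (fun n => J n (h.coord x n))
  · intro n
    refine ⟨h.coord x n, ?_⟩
    change J n (h.coord x n) = ∑ k ∈ Finset.range (n + 1), J k (h.coord x k) -
      ∑ k ∈ Finset.range n, J k (h.coord x k)
    rw [Finset.sum_range_succ, add_sub_cancel_left]
  · rfl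

theorem continuous_coord [CompleteSpace X] (h : IsSchauderDecomposition J) (n : ℕ) :
    Continuous fun x => h.coord x n := by
  have : CompleteSpace (sumSpace J) := h.isClosed_sumSpace.completeSpace_coe
  let e : sumSpace J ≃L[ℝ] X := ContinuousLinearEquiv.ofBijective (limMap J)
    (LinearMap.ker_eq_bot.2 h.limMap_injective) (LinearMap.range_eq_top.2 h.limMap_surjective)
  have he : ∀ x, limMap J (e.symm x) = x := fun x => e.apply_symm_apply x
  rw [(h.isClosedEmbedding n).isEmbedding.continuous_iff]
  have hc : Continuous fun x : X =>
      (e.symm x).1 ((n + 1 : ℕ) : OnePoint ℕ) - (e.symm x).1 (n : OnePoint ℕ) :=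
    (((continuous_eval_const _).comp continuous_subtype_val).comp
      e.symm.continuous).sub (((continuous_eval_const _).comp
        continuous_subtype_val).comp e.symm.continuous)
  refine hc.congr fun x => ?_
  rw [h.eq_sum_coord, h.eq_sum_coord, he, Finset.sum_range_succ]
  simp

/-- The projections `P n : X → Y n` of a Schauder decomposition, sending `x = ∑ J n (y n)` to
`y n`; they are automatically bounded. -/
def proj [CompleteSpace X] (h : IsSchauderDecomposition J) (n : ℕ) : X →L[ℝ] Y n where
  toFun x := h.coord x n
  map_add' x y := by rw [h.coord_add]; rfl
  map_smul' c x := by rw [h.coord_smul]; rfl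
  cont := h.continuous_coord n

end IsSchauderDecomposition

end Decomposition

end

/-! The operator `D` comes from a bounded dyadic martingale of nonnegative densities in `L¹`. If `T`
is not Dunford–Pettis, truncating a weakly compact set, which is uniformly integrable, gives a
uniformly bounded weakly null family `g i` with `‖T (g i)‖ ≥ δ`
(`exists_bounded_weakly_null_of_not_isDunfordPettis`). A Dunford–Pettis operator sends `ξ * g i` to
norm null families for each bounded density `ξ`, because bounded sets of `L²` are relatively weakly
compact in `L¹` (`IsDunfordPettis.tendsto_classL1`).

Starting from the density `1`, replace `ξ` at level `k` by `ξ (1 ± h)`, where `h` is some `g i` with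
`∫ ξ h` and `R j (ξ h)`, `j ≤ k`, of size at most `2⁻ᵏ`; here `R n = P_n T`. Nonnegativity turns
norms into integrals, so the tree stays bounded and defines `D`. The increments of `R n` are
summable uniformly, so the martingale converges to a bounded kernel and `R n D` is representable.

For a single `ξ` the size of `T (ξ h)` may be small. Its limit `φ ξ` along an ultrafilter is however
midpoint convex (`exists_gauge_of_not_isDunfordPettis`), so the average of `φ` over a level is at
least `φ 1 > 0`. The increments of `T` therefore stay large in mean, whereas representability of `T
D` would make them tend to zero by Lebesgue differentiation
(`IsDyadicMartingale.tendsto_increments_of_isRepresentable`). -/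

noncomputable section

/-! ### Weak compactness in normed and Hilbert spaces. -/

section WeakTopology

variable {E F : Type*} [NormedAddCommGroup E] [NormedSpace ℝ E]
  [NormedAddCommGroup F] [NormedSpace ℝ F]

theorem continuous_dual_weakSpace (ψ : StrongDual ℝ E) :
    Continuous fun x : WeakSpace ℝ E => ψ ((toWeakSpace ℝ E).symm x) :=
  WeakBilin.eval_continuous (topDualPairing ℝ E).flip ψ

/-- Norming functionals of a dense sequence suffice: if all of them kill `z` and `d` is a term close
to `z`, then `‖d‖ = |ψ (z - d)| ≤ ‖z - d‖`, impossible when `‖z - d‖ < ‖z‖ / 2`. -/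
theorem exists_countable_separating_dual [TopologicalSpace.SeparableSpace E] :
    ∃ ψ : ℕ → StrongDual ℝ E, ∀ x y : E, x ≠ y → ∃ n, ψ n x ≠ ψ n y := by
  choose ψ hψ1 hψ2 using fun n => exists_dual_vector'' ℝ (TopologicalSpace.denseSeq E n)
  refine ⟨ψ, fun x y hxy => ?_⟩
  by_contra! h
  have hz : ∀ n, ψ n (x - y) = 0 := fun n => by rw [map_sub, h n, sub_self]
  have hpos : 0 < ‖x - y‖ := norm_pos_iff.2 (sub_ne_zero.2 hxy)
  obtain ⟨n, hn⟩ := (TopologicalSpace.denseRange_denseSeq E).exists_dist_lt (x - y)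
    (half_pos hpos)
  rw [dist_eq_norm] at hn
  set d := TopologicalSpace.denseSeq E n
  have h1 : ‖d‖ ≤ ‖x - y - d‖ := by
    have h2 : ψ n (x - y - d) = -‖d‖ := by
      rw [map_sub, hz, zero_sub, hψ2]; rfl
    have h3 := (ψ n).le_of_opNorm_le (hψ1 n) (x - y - d)
    rw [h2, norm_neg, norm_norm, one_mul] at h3
    exact h3
  have h4 := norm_sub_norm_le (x - y) d
  linarith

/-- Sequential compactness of weakly compact sets in separable spaces. -/
theorem exists_weakly_convergent_subseq [TopologicalSpace.SeparableSpace E] {K : Set E}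
    (hK : IsCompact (toWeakSpace ℝ E '' K)) (u : ℕ → E) (hu : ∀ n, u n ∈ K) :
    ∃ x ∈ K, ∃ s : ℕ → ℕ, StrictMono s ∧
      ∀ ψ : StrongDual ℝ E, Tendsto (fun n => ψ (u (s n))) atTop (𝓝 (ψ x)) := by
  obtain ⟨ψ, hψ⟩ := exists_countable_separating_dual (E := E)
  have : CompactSpace (toWeakSpace ℝ E '' K) := isCompact_iff_compactSpace.mp hK
  -- A compact space with countably many continuous functions separating its points is metrizable,
  -- hence sequentially compact.
  have : TopologicalSpace.MetrizableSpace (toWeakSpace ℝ E '' K) :=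
    Metric.PiNatEmbed.TopologicalSpace.MetrizableSpace.of_countable_separating
      (fun n x => ψ n ((toWeakSpace ℝ E).symm x.1))
      (fun n => (continuous_dual_weakSpace (ψ n)).comp continuous_subtype_val)
      (fun x y hxy => hψ _ _ ((toWeakSpace ℝ E).symm.injective.ne (Subtype.val_injective.ne hxy)))
  let := TopologicalSpace.metrizableSpaceMetric (toWeakSpace ℝ E '' K)
  obtain ⟨⟨_, x, hx, rfl⟩, s, hs, hlim⟩ := CompactSpace.tendsto_subseq
    (fun n => (⟨toWeakSpace ℝ E (u n), u n, hu n, rfl⟩ : toWeakSpace ℝ E '' K))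
  refine ⟨x, hx, s, hs, fun χ => ?_⟩
  exact (((continuous_dual_weakSpace χ).comp continuous_subtype_val).tendsto _).comp hlim

theorem exists_weak_limit_ultrafilter {K : Set E} (hK : IsCompact (toWeakSpace ℝ E '' K))
    (U : Ultrafilter E) (hU : K ∈ U) :
    ∃ x ∈ K, ∀ ψ : StrongDual ℝ E, Tendsto ψ U (𝓝 (ψ x)) := by
  obtain ⟨_, ⟨x, hx, rfl⟩, hle⟩ := isCompact_iff_ultrafilter_le_nhds.1 hK
    (U.map (toWeakSpace ℝ E)) (by
      rw [le_principal_iff]; exact image_mem_map hU)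
  exact ⟨x, hx, fun ψ => ((continuous_dual_weakSpace ψ).tendsto _).comp hle⟩

/-- Uniform boundedness applied to `K` as a family of functionals on the dual, which is complete
even if `E` is not. -/
theorem exists_norm_le_of_weakly_compact {K : Set E} (hK : IsCompact (toWeakSpace ℝ E '' K)) :
    ∃ C, ∀ x ∈ K, ‖x‖ ≤ C := by
  obtain ⟨C, hC⟩ := banach_steinhaus
    (g := fun x : K => NormedSpace.inclusionInDoubleDual ℝ E x.1) (fun ψ => by
      obtain ⟨C, hC⟩ := hK.exists_bound_of_continuousOn (continuous_dual_weakSpace ψ).continuousOn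
      exact ⟨C, fun x => by simpa using hC _ ⟨x.1, x.2, rfl⟩⟩)
  refine ⟨C, fun x hx => ?_⟩
  have h := hC ⟨x, hx⟩
  rwa [show ‖NormedSpace.inclusionInDoubleDual ℝ E x‖ = ‖x‖ from
    (NormedSpace.inclusionInDoubleDualLi ℝ (E := E)).norm_map x] at h

theorem isCompact_toWeakSpace_image_image {K : Set E} (hK : IsCompact (toWeakSpace ℝ E '' K))
    (A : E →L[ℝ] F) : IsCompact (toWeakSpace ℝ F '' (A '' K)) := by
  have h := hK.image (WeakSpace.map A).continuous
  rwa [Set.image_image] at h ⊢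

/-- By Riesz representation this is Banach–Alaoglu. With `H = L²` it supplies weakly compact subsets
of `L¹`. -/
theorem isCompact_toWeakSpace_closedBall {H : Type*} [NormedAddCommGroup H]
    [InnerProductSpace ℝ H] [CompleteSpace H] (r : ℝ) :
    IsCompact (toWeakSpace ℝ H '' Metric.closedBall 0 r) := by
  have h := WeakDual.isCompact_closedBall (𝕜 := ℝ) (E := H) 0 r
  let m : WeakDual ℝ H → WeakSpace ℝ H := fun φ =>
    toWeakSpace ℝ H ((InnerProductSpace.toDual ℝ H).symm (WeakDual.toStrongDual φ))
  have hm : Continuous m := by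
    refine WeakBilin.continuous_of_continuous_eval _ fun ψ => ?_
    obtain ⟨q, rfl⟩ := (InnerProductSpace.toDual ℝ H).surjective ψ
    have : ∀ φ : WeakDual ℝ H, φ q = inner ℝ q
        ((InnerProductSpace.toDual ℝ H).symm (WeakDual.toStrongDual φ)) := fun φ => by
      rw [real_inner_comm, InnerProductSpace.toDual_symm_apply]; rfl
    exact (WeakDual.eval_continuous q).congr this
  convert h.image hm using 1
  ext y
  constructor
  · rintro ⟨x, hx, rfl⟩
    refine ⟨StrongDual.toWeakDual (InnerProductSpace.toDual ℝ H x), ?_, ?_⟩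
    · simpa using! hx
    · simp [m]
  · rintro ⟨φ, hφ, rfl⟩
    refine ⟨_, ?_, rfl⟩
    simpa using! hφ

/-- If `T` were Cauchy along every ultrafilter containing `K`, each image ultrafilter would converge
in norm, necessarily to `T x` with `x` the weak limit in `K`, and `T '' K` would be compact. -/
theorem exists_ultrafilter_of_not_isDunfordPettis [CompleteSpace F] {T : E →L[ℝ] F}
    (hT : ¬ IsDunfordPettis T) :
    ∃ K : Set E, IsCompact (toWeakSpace ℝ E '' K) ∧ ∃ U : Ultrafilter E, K ∈ U ∧
      ∃ δ : ℝ, 0 < δ ∧ ∀ S ∈ U, ∃ x ∈ S, ∃ y ∈ S, δ ≤ ‖T (x - y)‖ := by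
  by_contra! hcon
  refine hT fun K hK => ?_
  rw [isCompact_iff_ultrafilter_le_nhds]
  intro W hW
  rw [le_principal_iff] at hW
  set U := Ultrafilter.ofComapInfPrincipal hW
  have hKU : K ∈ U := Ultrafilter.ofComapInfPrincipal_mem hW
  have hUW : U.map T = W := Ultrafilter.ofComapInfPrincipal_eq_of_map hW
  have hcau : Cauchy (U.map T : Filter F) := by
    rw [Metric.cauchy_iff]
    refine ⟨inferInstance, fun ε hε => ?_⟩
    obtain ⟨S, hS, hS'⟩ := hcon K hK U hKU ε hε
    refine ⟨T '' S, image_mem_map hS, ?_⟩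
    rintro _ ⟨x, hx, rfl⟩ _ ⟨y, hy, rfl⟩
    rw [dist_eq_norm, ← map_sub]
    exact hS' x hx y hy
  obtain ⟨z, hz⟩ := CompleteSpace.complete hcau
  obtain ⟨x, hx, hxU⟩ := exists_weak_limit_ultrafilter hK U hKU
  have hzx : z = T x := by
    refine (SeparatingDual.eq_iff_forall_dual_eq (R := ℝ)).2 fun ψ => ?_
    exact tendsto_nhds_unique (((ψ.continuous.tendsto z).mono_left hz).comp
      (tendsto_map (f := T) (x := (U : Filter E)))) (hxU (ψ.comp T))
  refine ⟨T x, ⟨x, hx, rfl⟩, ?_⟩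
  rw [← hzx, ← hUW]
  exact hz

end WeakTopology

/-! ### Uniform integrability of weakly compact subsets of `L¹`. -/

section UniformIntegrability

variable {α : Type*} [MeasurableSpace α] {μ : Measure α}
  {Z : Type*} [NormedAddCommGroup Z] [NormedSpace ℝ Z]

theorem integrable_smul_of_bound {v : α → Z} (hv : AEStronglyMeasurable v μ) {C : ℝ}
    (hC : ∀ᵐ t ∂μ, ‖v t‖ ≤ C) (f : Lp ℝ 1 μ) : Integrable (fun t => f t • v t) μ :=
  (L1.integrable_coeFn f).smul_bdd C hv hC

theorem norm_integral_smul_le {v : α → Z} {C : ℝ} (hC : ∀ᵐ t ∂μ, ‖v t‖ ≤ C) {f : α → ℝ}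
    (hf : Integrable f μ) : ‖∫ t, f t • v t ∂μ‖ ≤ C * ∫ t, ‖f t‖ ∂μ := by
  rw [← integral_const_mul]
  refine norm_integral_le_of_norm_le (hf.norm.const_mul C) ?_
  filter_upwards [hC] with t ht
  rw [norm_smul, mul_comm]
  exact mul_le_mul_of_nonneg_right ht (norm_nonneg _)

/-- The operator `f ↦ ∫ f v` on `L¹` given by an essentially bounded vector function `v`. -/
def kernelOperator {v : α → Z} (hv : AEStronglyMeasurable v μ) {C : ℝ}
    (hC : ∀ᵐ t ∂μ, ‖v t‖ ≤ C) : Lp ℝ 1 μ →L[ℝ] Z :=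
  LinearMap.mkContinuous
    { toFun := fun f => ∫ t, f t • v t ∂μ
      map_add' := fun f g => by
        rw [← integral_add (integrable_smul_of_bound hv hC f) (integrable_smul_of_bound hv hC g)]
        refine integral_congr_ae ?_
        filter_upwards [Lp.coeFn_add f g] with t ht
        rw [ht, Pi.add_apply, add_smul]
      map_smul' := fun c f => by
        rw [RingHom.id_apply, ← integral_smul]
        refine integral_congr_ae ?_
        filter_upwards [Lp.coeFn_smul c f] with t ht
        rw [ht, Pi.smul_apply, smul_assoc] } C
    (fun f => by
      rw [L1.norm_eq_integral_norm]
      exact norm_integral_smul_le hC (L1.integrable_coeFn f))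

theorem kernelOperator_apply {v : α → Z} (hv : AEStronglyMeasurable v μ) {C : ℝ}
    (hC : ∀ᵐ t ∂μ, ‖v t‖ ≤ C) (f : Lp ℝ 1 μ) :
    kernelOperator hv hC f = ∫ t, f t • v t ∂μ := rfl

theorem norm_kernelOperator_apply_le {v : α → Z} (hv : AEStronglyMeasurable v μ) {C : ℝ}
    (hC : ∀ᵐ t ∂μ, ‖v t‖ ≤ C) (f : Lp ℝ 1 μ) : ‖kernelOperator hv hC f‖ ≤ C * ‖f‖ := by
  rw [L1.norm_eq_integral_norm]
  exact norm_integral_smul_le hC (L1.integrable_coeFn f)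

theorem isClosed_setOf_bounded_abs_integral_mul_le {h : α → ℝ} (hh : Integrable h μ) (ε : ℝ) :
    IsClosed {g : Lp ℝ 1 μ | (∀ᵐ t ∂μ, ‖g t‖ ≤ 1) ∧ |∫ t, g t * h t ∂μ| ≤ ε} := by
  refine IsSeqClosed.isClosed fun u g hu hug => ?_
  obtain ⟨s, -, hs⟩ := (tendstoInMeasure_of_tendsto_Lp hug).exists_seq_tendsto_ae
  have hall : ∀ᵐ t ∂μ, ∀ n, ‖u n t‖ ≤ 1 := ae_all_iff.2 fun n => (hu n).1
  refine ⟨?_, ?_⟩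
  · filter_upwards [hs, hall] with t ht ht'
    exact le_of_tendsto ht.norm (Eventually.of_forall fun n => ht' _)
  · have hlim : Tendsto (fun n => ∫ t, u (s n) t * h t ∂μ) atTop (𝓝 (∫ t, g t * h t ∂μ)) := by
      refine tendsto_integral_of_dominated_convergence (fun t => ‖h t‖)
        (fun n => (Lp.aestronglyMeasurable _).mul hh.1) hh.norm (fun n => ?_) ?_
      · filter_upwards [hall] with t ht
        rw [norm_mul]
        exact mul_le_of_le_one_left (norm_nonneg _) (ht _)
      · filter_upwards [hs] with t ht using ht.mul_const _
    exact le_of_tendsto hlim.abs (Eventually.of_forall fun n => (hu _).2)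

theorem measurable_signed_one {h : α → ℝ} (hh : Measurable h) :
    Measurable fun t => if 0 ≤ h t then (1 : ℝ) else -1 :=
  Measurable.ite (measurableSet_le measurable_const hh) measurable_const measurable_const

variable [IsFiniteMeasure μ]

/-- Weakly convergent sequences in `L¹` are equi-integrable. -/
theorem exists_setIntegral_norm_sub_le_of_weakly_convergent {u : ℕ → Lp ℝ 1 μ} {f : Lp ℝ 1 μ}
    (hu : ∀ ψ : StrongDual ℝ (Lp ℝ 1 μ), Tendsto (fun n => ψ (u n)) atTop (𝓝 (ψ f)))
    {ε : ℝ} (hε : 0 < ε) :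
    ∃ δ > 0, ∃ N, ∀ n ≥ N, ∀ B, MeasurableSet B → μ.real B < δ →
      ∫ t in B, ‖(u n - f) t‖ ∂μ ≤ ε := by
  classical
  -- Baire category in `Q`, the unit ball of `L^∞` with the `L¹` metric: weak convergence tested on
  -- the functional of each `g ∈ Q` shows that the closed sets `S N` cover `Q`.
  let S : ℕ → Set (Lp ℝ 1 μ) := fun N => ⋂ n : Set.Ici N,
    {g : Lp ℝ 1 μ | (∀ᵐ t ∂μ, ‖g t‖ ≤ 1) ∧ |∫ t, g t * (u n - f) t ∂μ| ≤ ε / 2}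
  have hS : ∀ N, IsClosed (S N) := fun N => isClosed_iInter fun n =>
    isClosed_setOf_bounded_abs_integral_mul_le (L1.integrable_coeFn _) _
  let Q : Set (Lp ℝ 1 μ) := {g : Lp ℝ 1 μ | ∀ᵐ t ∂μ, ‖g t‖ ≤ 1}
  have hQ : IsClosed Q := by
    have := isClosed_setOf_bounded_abs_integral_mul_le (μ := μ) (h := 0)
      (integrable_zero _ _ _) 0
    simpa using! this
  have : CompleteSpace Q := hQ.completeSpace_coe
  have : Nonempty Q := ⟨⟨0, by
    filter_upwards [Lp.coeFn_zero ℝ 1 μ] with t ht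
    rw [ht]
    simp⟩⟩
  have hcover : ⋃ N, ((↑) : Q → Lp ℝ 1 μ) ⁻¹' S N = Set.univ := by
    refine Set.eq_univ_of_forall fun g => ?_
    have h1 := hu (kernelOperator (Lp.aestronglyMeasurable g.1) g.2)
    have h2 := (Metric.tendsto_atTop.1 h1) (ε / 2) (half_pos hε)
    obtain ⟨N, hN⟩ := h2
    refine Set.mem_iUnion.2 ⟨N, Set.mem_iInter.2 fun n => ⟨g.2, ?_⟩⟩
    have h3 := (hN n n.2).le
    rw [Real.dist_eq, ← map_sub, kernelOperator_apply] at h3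
    simpa only [smul_eq_mul, mul_comm] using h3
  obtain ⟨N, g₀, hg₀⟩ := nonempty_interior_of_iUnion_of_closed
    (fun N => (hS N).preimage continuous_subtype_val) hcover
  obtain ⟨r, hr, hball⟩ := Metric.isOpen_iff.1 isOpen_interior g₀ hg₀
  -- Changing `g₀` on `B` within the bound `1` moves it by at most `2 μ(B) < r`, so the modified
  -- function stays in `S N`.
  refine ⟨r / 2, half_pos hr, N, fun n hn B hB hBr => ?_⟩
  have key : ∀ s : α → ℝ, Measurable s → (∀ t, ‖s t‖ ≤ 1) →
      |∫ t, B.piecewise s g₀.1 t * (u n - f) t ∂μ| ≤ ε / 2 := by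
    intro s hs hs1
    have hsm : Measurable (B.piecewise s g₀.1) :=
      hs.piecewise hB (Lp.stronglyMeasurable g₀.1).measurable
    have hb : ∀ᵐ t ∂μ, ‖B.piecewise s g₀.1 t‖ ≤ 1 := by
      filter_upwards [g₀.2] with t ht
      by_cases htB : t ∈ B
      · simpa [htB] using hs1 t
      · simpa [htB] using ht
    have hint : Integrable (B.piecewise s g₀.1) μ :=
      Integrable.of_bound hsm.aestronglyMeasurable 1 hb
    set g := hint.toL1 _
    have hgc : g =ᵐ[μ] B.piecewise s g₀.1 := hint.coeFn_toL1
    have hgQ : g ∈ Q := by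
      change ∀ᵐ t ∂μ, ‖g t‖ ≤ 1
      filter_upwards [hgc, hb] with t h1 h2
      rwa [h1]
    have hdist : dist (⟨g, hgQ⟩ : Q) g₀ < r := by
      rw [Subtype.dist_eq, dist_eq_norm, L1.norm_eq_integral_norm]
      have h1 : ∫ t, ‖(g - g₀.1) t‖ ∂μ ≤ ∫ t, B.indicator (fun _ => (2 : ℝ)) t ∂μ := by
        refine integral_mono_ae (L1.integrable_coeFn _).norm
          ((integrable_const _).indicator hB) ?_
        filter_upwards [hgc, Lp.coeFn_sub g g₀.1, g₀.2] with t h1 h2 h3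
        rw [h2, Pi.sub_apply, h1]
        by_cases htB : t ∈ B
        · simp only [htB, Set.piecewise_eq_of_mem, Set.indicator_of_mem]
          refine (norm_sub_le _ _).trans ?_
          linarith [hs1 t]
        · simp [htB]
      rw [integral_indicator_const _ hB, smul_eq_mul] at h1
      linarith
    have hmem := interior_subset (hball hdist)
    have h2 := (Set.mem_iInter.1 hmem ⟨n, hn⟩).2
    have h3 : ∫ t, g t * (u n - f) t ∂μ = ∫ t, B.piecewise s g₀.1 t * (u n - f) t ∂μ := by
      refine integral_congr_ae ?_
      filter_upwards [hgc] with t ht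
      rw [ht]
    rwa [← h3]
  have hhm : Measurable fun t => (u n - f) t := (Lp.stronglyMeasurable _).measurable
  -- Put the sign of `u n - f` on `B`, then `0` on `B`. Off `B` both functions equal `g₀`, so the
  -- two integrals differ by `∫_B ‖u n - f‖`.
  have hs1 := key _ (measurable_signed_one hhm) (fun t => by split_ifs <;> simp)
  have hs0 := key (fun _ => (0 : ℝ)) measurable_const (fun t => by simp)
  have hmulint : ∀ s : α → ℝ, Measurable s → (∀ t, ‖s t‖ ≤ 1) →
      Integrable (fun t => B.piecewise s g₀.1 t * (u n - f) t) μ := by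
    intro s hs hs1
    refine (L1.integrable_coeFn (u n - f)).bdd_mul (c := 1)
      (hs.piecewise hB (Lp.stronglyMeasurable g₀.1).measurable).aestronglyMeasurable ?_
    filter_upwards [g₀.2] with t ht
    by_cases htB : t ∈ B
    · simpa [htB] using hs1 t
    · simpa [htB] using ht
  have hsub := integral_sub (hmulint _ (measurable_signed_one hhm)
    (fun t => by split_ifs <;> simp)) (hmulint (fun _ => (0 : ℝ)) measurable_const (fun t => by simp))
  rw [← integral_indicator hB]
  have hpt : ∀ t, B.indicator (fun t => ‖(u n - f) t‖) t =
      B.piecewise (fun t => if 0 ≤ (u n - f) t then (1 : ℝ) else -1) g₀.1 t * (u n - f) t -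
      B.piecewise (fun _ => (0 : ℝ)) g₀.1 t * (u n - f) t := by
    intro t
    by_cases htB : t ∈ B
    · simp only [htB, Set.indicator_of_mem, Set.piecewise_eq_of_mem, zero_mul,
        sub_zero, Real.norm_eq_abs]
      split_ifs with h0
      · rw [abs_of_nonneg h0, one_mul]
      · rw [abs_of_neg (not_le.1 h0)]; ring
    · simp [htB]
  rw [integral_congr_ae (Eventually.of_forall hpt), hsub]
  have := (abs_le.1 hs1).2
  have := (abs_le.1 hs0).1
  linarith

/-- Weakly compact subsets of `L¹` are uniformly integrable. -/
theorem exists_setIntegral_norm_le_of_weakly_compact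
    [TopologicalSpace.SeparableSpace (Lp ℝ 1 μ)] {K : Set (Lp ℝ 1 μ)}
    (hK : IsCompact (toWeakSpace ℝ (Lp ℝ 1 μ) '' K)) {η : ℝ} (hη : 0 < η) :
    ∃ M : ℕ, ∀ f ∈ K, ∫ t in {t | (M : ℝ) < ‖f t‖}, ‖f t‖ ∂μ ≤ η := by
  by_contra! hcon
  choose v hvK hv using hcon
  obtain ⟨C, hC⟩ := exists_norm_le_of_weakly_compact hK
  obtain ⟨f, -, s, hs, hlim⟩ := exists_weakly_convergent_subseq hK v hvK
  obtain ⟨δ, hδ, N, hN⟩ := exists_setIntegral_norm_sub_le_of_weakly_convergent hlim (half_pos hη)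
  -- By Chebyshev and the norm bound `C` these sets have measure tending to zero; equi-integrability
  -- of `v (s n) - f` and integrability of `f` then contradict the choice of `v`.
  let B : ℕ → Set α := fun n => {t | (s n : ℝ) < ‖v (s n) t‖}
  have hBm : ∀ n, MeasurableSet (B n) := fun n =>
    measurableSet_lt measurable_const (Lp.stronglyMeasurable _).norm.measurable
  have hsn : Tendsto (fun n => (s n : ℝ)) atTop atTop :=
    tendsto_natCast_atTop_atTop.comp hs.tendsto_atTop
  have hBreal : Tendsto (fun n => μ.real (B n)) atTop (𝓝 0) := by
    have h0 : Tendsto (fun n => C / (s n : ℝ)) atTop (𝓝 0) := hsn.const_div_atTop C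
    refine squeeze_zero' (Eventually.of_forall fun n => measureReal_nonneg) ?_ h0
    filter_upwards [hsn.eventually_gt_atTop 0] with n hn
    rw [le_div_iff₀ hn, mul_comm]
    have h1 := mul_meas_ge_le_integral_of_nonneg (μ := μ) (f := fun t => ‖v (s n) t‖)
      (Eventually.of_forall fun t => norm_nonneg _) (L1.integrable_coeFn _).norm (s n)
    rw [← L1.norm_eq_integral_norm] at h1
    refine le_trans ?_ (h1.trans (hC _ (hvK _)))
    exact mul_le_mul_of_nonneg_left (measureReal_mono fun t ht => (Set.mem_ofPred_eq ▸ ht : _ < _).le) hn.le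
  have hB0 : Tendsto (μ ∘ B) atTop (𝓝 0) := by
    have := ENNReal.tendsto_ofReal hBreal
    simpa [Measure.real, Function.comp_def] using this
  have hf := (L1.integrable_coeFn f).norm.tendsto_setIntegral_nhds_zero hB0
  obtain ⟨n, hn1, hn2, hn3⟩ := ((eventually_ge_atTop N).and
    ((hBreal.eventually_lt_const hδ).and (hf.eventually_lt_const (half_pos hη)))).exists
  have h1 := hN n hn1 (B n) (hBm n) hn2
  have h2 := hv (s n)
  have h3 : ∫ t in B n, ‖v (s n) t‖ ∂μ ≤
      ∫ t in B n, (‖(v (s n) - f) t‖ + ‖f t‖) ∂μ := by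
    refine integral_mono_ae (L1.integrable_coeFn _).norm.integrableOn
      ((L1.integrable_coeFn _).norm.add (L1.integrable_coeFn _).norm).integrableOn ?_
    refine ae_restrict_of_ae ?_
    filter_upwards [Lp.coeFn_sub (v (s n)) f] with t ht
    rw [ht, Pi.sub_apply]
    simpa using norm_add_le (v (s n) t - f t) (f t)
  rw [integral_add (L1.integrable_coeFn _).norm.integrableOn
    (L1.integrable_coeFn _).norm.integrableOn] at h3
  exact absurd h2 (not_lt.2 (by linarith))

end UniformIntegrability

/-! ### Bounded weakly null families and Dunford–Pettis operators. -/

section BoundedPerturbations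

variable {α : Type*} [MeasurableSpace α] {μ : Measure α}

open Classical in
/-- The class in `L¹` of an integrable function. -/
def classL1 (μ : Measure α) (f : α → ℝ) : Lp ℝ 1 μ :=
  if h : Integrable f μ then h.toL1 f else 0

theorem classL1_of_integrable {f : α → ℝ} (hf : Integrable f μ) : classL1 μ f = hf.toL1 f :=
  dif_pos hf

theorem coeFn_classL1 {f : α → ℝ} (hf : Integrable f μ) : classL1 μ f =ᵐ[μ] f := by
  rw [classL1_of_integrable hf]; exact hf.coeFn_toL1

theorem classL1_add {f g : α → ℝ} (hf : Integrable f μ) (hg : Integrable g μ) :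
    classL1 μ (fun t => f t + g t) = classL1 μ f + classL1 μ g := by
  rw [classL1_of_integrable hf, classL1_of_integrable hg, ← Integrable.toL1_add]
  exact classL1_of_integrable (hf.add hg)

theorem classL1_sub {f g : α → ℝ} (hf : Integrable f μ) (hg : Integrable g μ) :
    classL1 μ (fun t => f t - g t) = classL1 μ f - classL1 μ g := by
  rw [classL1_of_integrable hf, classL1_of_integrable hg, ← Integrable.toL1_sub]
  exact classL1_of_integrable (hf.sub hg)

theorem norm_classL1 {f : α → ℝ} (hf : Integrable f μ) :
    ‖classL1 μ f‖ = ∫ t, ‖f t‖ ∂μ := by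
  rw [L1.norm_eq_integral_norm]
  refine integral_congr_ae ?_
  filter_upwards [coeFn_classL1 hf] with t ht
  rw [ht]

/-- Truncation of a function at height `M`, scaled to take values in `[-1/2, 1/2]`. -/
def scaledTrunc {β : Type*} (M : ℝ) (f : β → ℝ) (t : β) : ℝ :=
  if ‖f t‖ ≤ M then f t / (2 * M) else 0

theorem measurable_scaledTrunc (M : ℝ) {f : α → ℝ} (hf : Measurable f) :
    Measurable (scaledTrunc M f) :=
  Measurable.ite (measurableSet_le hf.norm measurable_const) (hf.div_const _) measurable_const

theorem norm_scaledTrunc_le {β : Type*} {M : ℝ} (hM : 0 < M) (f : β → ℝ) (t : β) :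
    ‖scaledTrunc M f t‖ ≤ 1 / 2 := by
  unfold scaledTrunc
  split_ifs with h
  · rw [norm_div, Real.norm_of_nonneg (by positivity : 0 ≤ 2 * M), div_le_div_iff₀ (by positivity)
      two_pos]
    linarith
  · simp

theorem norm_sub_scaledTrunc {β : Type*} {M : ℝ} (hM : 0 < M) (f : β → ℝ) (t : β) :
    ‖f t - 2 * M * scaledTrunc M f t‖ = {t | M < ‖f t‖}.indicator (fun t => ‖f t‖) t := by
  unfold scaledTrunc
  by_cases h : ‖f t‖ ≤ M
  · rw [if_pos h, Set.indicator_of_notMem (by simpa using h), mul_div_cancel₀ _ (by positivity),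
      sub_self, norm_zero]
  · rw [if_neg h, Set.indicator_of_mem (by simpa using h), mul_zero, sub_zero]

theorem ultrafilter_exists_tendsto_of_bound {β : Type*} (U : Ultrafilter β) {F : β → ℝ} {C : ℝ}
    (hF : ∀ x, |F x| ≤ C) : ∃ l, Tendsto F U (𝓝 l) := by
  obtain ⟨l, -, hl⟩ := (isCompact_Icc (a := -C) (b := C)).ultrafilter_le_nhds (U.map F)
    (le_principal_iff.2 (Eventually.of_forall (f := (U : Filter β)) fun x => abs_le.1 (hF x)))
  exact ⟨l, hl⟩

theorem abs_integral_mul_le {q g : α → ℝ} (hq : Integrable q μ) {C : ℝ} (hg : ∀ t, ‖g t‖ ≤ C) :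
    |∫ t, q t * g t ∂μ| ≤ C * ∫ t, ‖q t‖ ∂μ :=
  norm_integral_smul_le (Eventually.of_forall hg) hq

variable [IsFiniteMeasure μ]

theorem integrable_of_measurable_bound {f : α → ℝ} (hf : Measurable f) {C : ℝ}
    (hC : ∀ t, ‖f t‖ ≤ C) : Integrable f μ :=
  Integrable.of_bound hf.aestronglyMeasurable C (Eventually.of_forall hC)

/-- A non-Dunford-Pettis operator on `L¹` is bounded below along a uniformly bounded weakly null
family. -/
theorem exists_bounded_weakly_null_of_not_isDunfordPettis
    [TopologicalSpace.SeparableSpace (Lp ℝ 1 μ)]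
    {X : Type*} [NormedAddCommGroup X] [NormedSpace ℝ X] [CompleteSpace X]
    {T : Lp ℝ 1 μ →L[ℝ] X} (hT : ¬ IsDunfordPettis T) :
    ∃ (V : Ultrafilter (Lp ℝ 1 μ × Lp ℝ 1 μ)) (g : Lp ℝ 1 μ × Lp ℝ 1 μ → α → ℝ),
      (∀ i, Measurable (g i)) ∧ (∀ i t, ‖g i t‖ ≤ 1) ∧
      (∀ q, Integrable q μ → Tendsto (fun i => ∫ t, q t * g i t ∂μ) V (𝓝 0)) ∧
      ∃ δ > 0, ∀ᶠ i in V, δ ≤ ‖T (classL1 μ (g i))‖ := by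
  obtain ⟨K, hK, U, hKU, δ, hδ, hU⟩ := exists_ultrafilter_of_not_isDunfordPettis hT
  have hTpos : 0 < ‖T‖ + 1 := by positivity
  -- With this tail bound each truncation costs `T` at most `δ / 4`, leaving `δ / 2` for `2 M ‖T (a
  -- - b)‖`. Adding `1` to `‖T‖` and to `M₀` keeps the divisors positive.
  obtain ⟨M₀, hM₀⟩ := exists_setIntegral_norm_le_of_weakly_compact hK
    (η := δ / (4 * (‖T‖ + 1))) (by positivity)
  set M : ℝ := M₀ + 1
  have hM : 0 < M := by positivity
  have hmeas : ∀ x : Lp ℝ 1 μ, Measurable (scaledTrunc M x) := fun x =>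
    measurable_scaledTrunc M (Lp.stronglyMeasurable x).measurable
  have hint : ∀ x : Lp ℝ 1 μ, Integrable (scaledTrunc M x) μ := fun x =>
    integrable_of_measurable_bound (hmeas x) (norm_scaledTrunc_le hM x)
  have htrunc : ∀ x ∈ K, ‖x - (2 * M) • classL1 μ (scaledTrunc M x)‖ ≤
      δ / (4 * (‖T‖ + 1)) := by
    intro x hx
    refine le_trans ?_ (hM₀ x hx)
    have hms : MeasurableSet {t | (M₀ : ℝ) < ‖x t‖} :=
      measurableSet_lt measurable_const (Lp.stronglyMeasurable x).norm.measurable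
    rw [L1.norm_eq_integral_norm, ← integral_indicator hms]
    refine integral_mono_ae (L1.integrable_coeFn _).norm
      ((L1.integrable_coeFn _).norm.indicator hms) ?_
    filter_upwards [Lp.coeFn_sub x ((2 * M) • classL1 μ (scaledTrunc M x)),
      Lp.coeFn_smul (2 * M) (classL1 μ (scaledTrunc M x)), coeFn_classL1 (hint x)]
      with t h1 h2 h3
    rw [h1, Pi.sub_apply, h2, Pi.smul_apply, h3, smul_eq_mul, norm_sub_scaledTrunc hM]
    refine Set.indicator_le_indicator_of_subset (fun s hs => ?_) (fun s => norm_nonneg _) t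
    rw [Set.mem_ofPred_eq] at hs ⊢
    exact lt_trans (lt_add_one _) hs
  -- Pairs from `U × U` that `T` keeps `δ` apart; this filter is proper by the choice of `U`.
  let F : Filter (Lp ℝ 1 μ × Lp ℝ 1 μ) :=
    ((U : Filter _) ×ˢ (U : Filter _)) ⊓ 𝓟 {p | δ ≤ ‖T (p.1 - p.2)‖}
  have hF : F.NeBot := by
    rw [inf_principal_neBot_iff]
    intro S hS
    obtain ⟨A, hA, B, hB, hAB⟩ := mem_prod_iff.1 hS
    obtain ⟨x, hx, y, hy, hxy⟩ := hU (A ∩ B) (inter_mem hA hB)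
    exact ⟨(x, y), hAB ⟨hx.1, hy.2⟩, hxy⟩
  have hVF : (Ultrafilter.of F : Filter _) ≤ F := Ultrafilter.of_le F
  refine ⟨Ultrafilter.of F, fun p t => scaledTrunc M p.1 t - scaledTrunc M p.2 t,
    fun p => (hmeas _).sub (hmeas _), fun p t => ?_, fun q hq => ?_, δ / (4 * M), by positivity, ?_⟩
  · have := norm_sub_le (scaledTrunc M p.1 t) (scaledTrunc M p.2 t)
    linarith [norm_scaledTrunc_le hM p.1 t, norm_scaledTrunc_le hM p.2 t]
  -- Both coordinates have the same limit `l` along `U`, so the difference tends to zero against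
  -- `q`. The factor `1 / 2` in the truncation keeps this difference bounded by `1`.
  · obtain ⟨l, hl⟩ := ultrafilter_exists_tendsto_of_bound U
      (F := fun x : Lp ℝ 1 μ => ∫ t, q t * scaledTrunc M x t ∂μ)
      (fun x => abs_integral_mul_le hq (norm_scaledTrunc_le hM x))
    have h1 := ((hl.comp tendsto_fst).sub (hl.comp tendsto_snd)).mono_left
      (hVF.trans inf_le_left)
    rw [sub_self] at h1
    refine h1.congr fun p => ?_
    have hqi : ∀ x : Lp ℝ 1 μ, Integrable (fun t => q t * scaledTrunc M x t) μ := fun x =>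
      hq.mul_bdd (hmeas x).aestronglyMeasurable
        (Eventually.of_forall (norm_scaledTrunc_le hM x))
    simp only [Function.comp_apply]
    rw [← integral_sub (hqi _) (hqi _)]
    simp only [mul_sub]
  · have hKK : ∀ᶠ p in F, p.1 ∈ K ∧ p.2 ∈ K :=
      Filter.Eventually.filter_mono inf_le_left (prod_mem_prod hKU hKU)
    have hd : ∀ᶠ p in F, δ ≤ ‖T (p.1 - p.2)‖ :=
      Filter.Eventually.filter_mono inf_le_right (mem_principal_self _)
    refine Filter.Eventually.filter_mono hVF ?_
    filter_upwards [hKK, hd] with p hp hpd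
    rw [classL1_sub (hint _) (hint _)]
    set a := classL1 μ (scaledTrunc M p.1)
    set b := classL1 μ (scaledTrunc M p.2)
    have hsplit : T (p.1 - p.2) = T (p.1 - (2 * M) • a) - T (p.2 - (2 * M) • b) +
        (2 * M) • T (a - b) := by
      rw [← map_smul, ← map_sub, ← map_add]
      congr 1
      rw [smul_sub]
      abel
    have hT1 : ∀ x : Lp ℝ 1 μ, ‖x‖ ≤ δ / (4 * (‖T‖ + 1)) → ‖T x‖ ≤ δ / 4 := by
      intro x hx
      refine (T.le_opNorm x).trans ?_
      have h2 : ‖T‖ * ‖x‖ ≤ (‖T‖ + 1) * (δ / (4 * (‖T‖ + 1))) := by gcongr; linarith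
      refine h2.trans (le_of_eq ?_)
      field_simp
    have h3 := norm_add_le (T (p.1 - (2 * M) • a) - T (p.2 - (2 * M) • b)) ((2 * M) • T (a - b))
    have h4 := norm_sub_le (T (p.1 - (2 * M) • a)) (T (p.2 - (2 * M) • b))
    rw [← hsplit, norm_smul, Real.norm_of_nonneg (by positivity : 0 ≤ 2 * M)] at h3
    have h5 := hT1 _ (htrunc _ hp.1)
    have h6 := hT1 _ (htrunc _ hp.2)
    rw [div_le_iff₀ (by positivity)]
    linarith

/-- The inclusion of `L²` into `L¹` of a finite measure. -/
def inclusionL2L1 (μ : Measure α) [IsFiniteMeasure μ] : Lp ℝ 2 μ →L[ℝ] Lp ℝ 1 μ :=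
  LinearMap.mkContinuous
    { toFun := fun f => ((Lp.memLp f).mono_exponent one_le_two).toLp f
      map_add' := fun f g => by
        rw [← MemLp.toLp_add]
        exact MemLp.toLp_congr _ _ (Lp.coeFn_add f g)
      map_smul' := fun c f => by
        rw [RingHom.id_apply, ← MemLp.toLp_const_smul]
        exact MemLp.toLp_congr _ _ (Lp.coeFn_smul c f) }
    ((μ Set.univ) ^ (1 / (1 : ℝ≥0∞).toReal - 1 / (2 : ℝ≥0∞).toReal)).toReal
    (fun f => by
      rw [mul_comm]
      change ‖((Lp.memLp f).mono_exponent one_le_two).toLp f‖ ≤ _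
      rw [Lp.norm_toLp, Lp.norm_def, ← ENNReal.toReal_mul]
      refine ENNReal.toReal_mono (ENNReal.mul_ne_top (Lp.eLpNorm_ne_top f)
        (ENNReal.rpow_ne_top_of_nonneg (by norm_num) (measure_ne_top _ _))) ?_
      exact eLpNorm_le_eLpNorm_mul_rpow_measure_univ one_le_two (Lp.aestronglyMeasurable f))

theorem inclusionL2L1_toLp {f : α → ℝ} (hf : MemLp f 2 μ) (hf' : Integrable f μ) :
    inclusionL2L1 μ (hf.toLp f) = classL1 μ f := by
  rw [classL1_of_integrable hf']
  exact MemLp.toLp_congr ((Lp.memLp _).mono_exponent one_le_two)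
    (memLp_one_iff_integrable.2 hf') hf.coeFn_toLp

/-- A Dunford-Pettis operator on `L¹` maps uniformly bounded weakly null families to norm null
families. -/
theorem IsDunfordPettis.tendsto_classL1 {Y : Type*} [NormedAddCommGroup Y] [NormedSpace ℝ Y]
    {R : Lp ℝ 1 μ →L[ℝ] Y} (hR : IsDunfordPettis R) {β : Type*} (V : Ultrafilter β)
    {g : β → α → ℝ} (hg : ∀ i, Measurable (g i)) {C : ℝ} (hC : ∀ i t, ‖g i t‖ ≤ C)
    (hnull : ∀ q, Integrable q μ → Tendsto (fun i => ∫ t, q t * g i t ∂μ) V (𝓝 0)) :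
    Tendsto (fun i => R (classL1 μ (g i))) V (𝓝 0) := by
  have hL2 : ∀ i, MemLp (g i) 2 μ := fun i =>
    MemLp.of_bound (hg i).aestronglyMeasurable C (Eventually.of_forall (hC i))
  have hL1 : ∀ i, Integrable (g i) μ := fun i => integrable_of_measurable_bound (hg i) (hC i)
  obtain ⟨r, hr⟩ : ∃ r, ∀ i, ‖(hL2 i).toLp (g i)‖ ≤ r := by
    refine ⟨_, fun i => Lp.norm_le_of_ae_bound (C := max C 0) (le_max_right _ _) ?_⟩
    filter_upwards [(hL2 i).coeFn_toLp] with t ht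
    rw [ht]
    exact (hC i t).trans (le_max_left _ _)
  -- The family lies in the image of an `L²` ball, which is weakly compact in `L¹`, so its image
  -- under `R` has a norm limit along `V`.
  have hcomp := hR _ (isCompact_toWeakSpace_image_image
    (isCompact_toWeakSpace_closedBall (H := Lp ℝ 2 μ) r) (inclusionL2L1 μ))
  obtain ⟨y, -, hy⟩ := hcomp.ultrafilter_le_nhds (V.map fun i => R (classL1 μ (g i)))
    (le_principal_iff.2 (Eventually.of_forall (f := (V : Filter β)) fun i =>
      ⟨_, ⟨(hL2 i).toLp (g i), by simpa using hr i, inclusionL2L1_toLp (hL2 i) (hL1 i)⟩, rfl⟩))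
  have hy' : Tendsto (fun i => R (classL1 μ (g i))) V (𝓝 y) := hy
  suffices y = 0 by rwa [this] at hy'
  refine (SeparatingDual.eq_zero_iff_forall_dual_eq_zero (R := ℝ) y).2 fun ψ => ?_
  -- On `L²` the functional `ψ ∘ R` is integration against some `q ∈ L² ⊆ L¹`, so `hnull` forces `ψ
  -- y = 0`.
  obtain ⟨q, hq⟩ := (InnerProductSpace.toDual ℝ (Lp ℝ 2 μ)).surjective
    ((ψ.comp R).comp (inclusionL2L1 μ))
  refine tendsto_nhds_unique ((ψ.continuous.tendsto y).comp hy') ?_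
  refine (hnull q ((Lp.memLp q).integrable one_le_two)).congr fun i => ?_
  have h1 := DFunLike.congr_fun hq ((hL2 i).toLp (g i))
  rw [InnerProductSpace.toDual_apply_apply, L2.inner_def] at h1
  simp only [ContinuousLinearMap.comp_apply, inclusionL2L1_toLp (hL2 i) (hL1 i)] at h1
  rw [Function.comp_apply, ← h1]
  refine integral_congr_ae ?_
  filter_upwards [(hL2 i).coeFn_toLp] with t ht
  rw [ht]
  simp [mul_comm]

end BoundedPerturbations

/-! ### Dyadic intervals and Lebesgue differentiation. -/

section DyadicIntervals

/-- The dyadic interval `[i / 2 ^ k, (i + 1) / 2 ^ k)`. -/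
def dyadicIco (k i : ℕ) : Set ℝ := Set.Ico ((i : ℝ) / 2 ^ k) (((i : ℝ) + 1) / 2 ^ k)

/-- The index of the dyadic interval of order `k` containing `t ≥ 0`. -/
def dyadicIndex (k : ℕ) (t : ℝ) : ℕ := ⌊(2 : ℝ) ^ k * t⌋₊

theorem mem_dyadicIco {k i : ℕ} {t : ℝ} :
    t ∈ dyadicIco k i ↔ (i : ℝ) ≤ 2 ^ k * t ∧ 2 ^ k * t < i + 1 := by
  have h : (0 : ℝ) < 2 ^ k := by positivity
  rw [dyadicIco, Set.mem_Ico, div_le_iff₀ h, lt_div_iff₀ h, mul_comm t]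

theorem measurableSet_dyadicIco (k i : ℕ) : MeasurableSet (dyadicIco k i) := measurableSet_Ico

theorem dyadicIndex_eq_of_mem {k i : ℕ} {t : ℝ} (ht : t ∈ dyadicIco k i) :
    dyadicIndex k t = i := by
  rw [mem_dyadicIco] at ht
  exact (Nat.floor_eq_iff ((Nat.cast_nonneg i).trans ht.1)).2 ht

theorem mem_dyadicIco_dyadicIndex (k : ℕ) {t : ℝ} (ht : 0 ≤ t) :
    t ∈ dyadicIco k (dyadicIndex k t) :=
  mem_dyadicIco.2 ⟨Nat.floor_le (by positivity), Nat.lt_floor_add_one _⟩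

theorem dyadicIndex_lt {k : ℕ} {t : ℝ} (ht0 : 0 ≤ t) (ht : t < 1) : dyadicIndex k t < 2 ^ k := by
  rw [dyadicIndex, Nat.floor_lt (by positivity)]
  push_cast
  exact mul_lt_of_lt_one_right (by positivity) ht

theorem dyadicIndex_succ_div_two (k : ℕ) (t : ℝ) :
    dyadicIndex (k + 1) t / 2 = dyadicIndex k t := by
  rw [dyadicIndex, ← Nat.floor_div_natCast, dyadicIndex]
  congr 1
  rw [pow_succ]
  push_cast
  ring

theorem measurable_dyadicIndex (k : ℕ) : Measurable (dyadicIndex k) :=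
  Nat.measurable_floor.comp (measurable_const_mul _)

theorem volume_real_dyadicIco (k i : ℕ) : volume.real (dyadicIco k i) = 1 / 2 ^ k := by
  rw [dyadicIco, Real.volume_real_Ico_of_le (by gcongr; linarith)]
  ring

theorem dyadicIco_eq_union (k i : ℕ) :
    dyadicIco k i = dyadicIco (k + 1) (2 * i) ∪ dyadicIco (k + 1) (2 * i + 1) := by
  ext t
  simp only [Set.mem_union, mem_dyadicIco, pow_succ]
  push_cast
  constructor
  · rintro ⟨h1, h2⟩
    rcases lt_or_ge (2 ^ k * 2 * t) (2 * (i : ℝ) + 1) with h | h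
    · left; constructor <;> linarith
    · right; constructor <;> linarith
  · rintro (⟨h1, h2⟩ | ⟨h1, h2⟩) <;> constructor <;> linarith

theorem disjoint_dyadicIco {k i j : ℕ} (hij : i ≠ j) :
    Disjoint (dyadicIco k i) (dyadicIco k j) :=
  Set.disjoint_left.2 fun _ h1 h2 =>
    hij ((dyadicIndex_eq_of_mem h1).symm.trans (dyadicIndex_eq_of_mem h2))

theorem dyadicIco_subset {k i : ℕ} (hi : i < 2 ^ k) : dyadicIco k i ⊆ dyadicIco 0 0 := by
  intro t ht
  rw [mem_dyadicIco] at ht ⊢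
  have h : (0 : ℝ) < 2 ^ k := by positivity
  have hi' : (i : ℝ) + 1 ≤ 2 ^ k := by exact_mod_cast hi
  have h0 : (0 : ℝ) ≤ i := Nat.cast_nonneg i
  simp only [pow_zero, one_mul, Nat.cast_zero, zero_add]
  constructor
  · exact nonneg_of_mul_nonneg_right (h0.trans ht.1) h
  · by_contra! h1
    nlinarith

theorem unitMeasure_eq : unitMeasure = volume.restrict (dyadicIco 0 0) := by
  rw [unitMeasure, restrict_Ioo_eq_restrict_Ico]
  simp [dyadicIco]

theorem unitMeasure_restrict_dyadicIco {k i : ℕ} (hi : i < 2 ^ k) :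
    unitMeasure.restrict (dyadicIco k i) = volume.restrict (dyadicIco k i) := by
  rw [unitMeasure_eq, Measure.restrict_restrict (measurableSet_dyadicIco k i),
    Set.inter_eq_left.2 (dyadicIco_subset hi)]

theorem ae_unitMeasure_mem : ∀ᵐ t ∂unitMeasure, t ∈ Set.Ioo (0 : ℝ) 1 :=
  ae_restrict_mem measurableSet_Ioo

variable {Z : Type*} [NormedAddCommGroup Z] [NormedSpace ℝ Z]

theorem setIntegral_dyadicIco_split {F : ℝ → Z} {k i : ℕ}
    (hF : IntegrableOn F (dyadicIco k i)) :
    ∫ t in dyadicIco k i, F t = (∫ t in dyadicIco (k + 1) (2 * i), F t) +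
      ∫ t in dyadicIco (k + 1) (2 * i + 1), F t := by
  rw [dyadicIco_eq_union] at hF ⊢
  exact setIntegral_union (disjoint_dyadicIco (by omega)) (measurableSet_dyadicIco _ _)
    (hF.mono_set Set.subset_union_left) (hF.mono_set Set.subset_union_right)

theorem setIntegral_eq_zero_of_dyadic {F : ℝ → Z} (hF : IntegrableOn F (dyadicIco 0 0)) {m : ℕ}
    (h0 : ∀ i < 2 ^ m, ∫ t in dyadicIco m i, F t = 0) : ∫ t in dyadicIco 0 0, F t = 0 := by
  suffices ∀ n k i, k + n = m → i < 2 ^ k → ∫ t in dyadicIco k i, F t = 0 from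
    this m 0 0 (zero_add m) (by norm_num)
  intro n
  induction n with
  | zero => rintro k i rfl hi; exact h0 i hi
  | succ n ih =>
    intro k i hk hi
    rw [setIntegral_dyadicIco_split (hF.mono_set (dyadicIco_subset hi)),
      ih (k + 1) (2 * i) (by omega) (by rw [pow_succ]; omega),
      ih (k + 1) (2 * i + 1) (by omega) (by rw [pow_succ]; omega), add_zero]

/-- Lebesgue differentiation along dyadic intervals. -/
theorem ae_tendsto_dyadic_average [CompleteSpace Z] {g : ℝ → Z} (hg : Integrable g unitMeasure) :
    ∀ᵐ t ∂unitMeasure, Tendsto (fun k : ℕ => (2 : ℝ) ^ k •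
      ∫ s in dyadicIco k (dyadicIndex k t), g s) atTop (𝓝 (g t)) := by
  have hG : Integrable ((dyadicIco 0 0).indicator g) volume := by
    rw [integrable_indicator_iff (measurableSet_dyadicIco 0 0), IntegrableOn, ← unitMeasure_eq]
    exact hg
  have h := ae_restrict_of_ae (s := Set.Ioo (0 : ℝ) 1)
    (IsUnifLocDoublingMeasure.ae_tendsto_average volume hG.locallyIntegrable 1)
  filter_upwards [h, ae_unitMeasure_mem] with t ht ht01
  have h2 : ∀ k : ℕ, (0 : ℝ) < 2 ^ k := fun k => by positivity
  -- A dyadic interval is, up to a null set, the closed ball about its midpoint. The differentiation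
  -- theorem allows balls that contain `t` without being centred there.
  have hball : ∀ k i : ℕ, Metric.closedBall (((i : ℝ) + 1 / 2) / 2 ^ k) (1 / 2 / 2 ^ k) =
      Set.Icc ((i : ℝ) / 2 ^ k) (((i : ℝ) + 1) / 2 ^ k) := fun k i => by
    rw [Real.closedBall_eq_Icc]
    congr 1 <;> ring
  have hmem : ∀ k, t ∈ dyadicIco k (dyadicIndex k t) := fun k =>
    mem_dyadicIco_dyadicIndex k ht01.1.le
  have hlim : Tendsto (fun k : ℕ => (1 / 2 / 2 ^ k : ℝ)) atTop (𝓝[>] 0) := by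
    refine tendsto_nhdsWithin_iff.2 ⟨?_, Eventually.of_forall fun k => ?_⟩
    · exact (tendsto_pow_atTop_atTop_of_one_lt one_lt_two).const_div_atTop _
    · exact div_pos (by norm_num) (h2 k)
  have h3 := ht (fun k : ℕ => ((dyadicIndex k t : ℝ) + 1 / 2) / 2 ^ k)
    (fun k : ℕ => (1 / 2 / 2 ^ k : ℝ)) hlim (Eventually.of_forall fun k => by
      rw [one_mul, hball]; exact Set.Ico_subset_Icc_self (hmem k))
  rw [Set.indicator_of_mem (by simpa [dyadicIco] using ⟨ht01.1.le, ht01.2⟩)] at h3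
  refine h3.congr fun k => ?_
  rw [hball, setAverage_eq, measureReal_congr Ico_ae_eq_Icc.symm,
    setIntegral_congr_set Ico_ae_eq_Icc.symm]
  change (volume.real (dyadicIco k _))⁻¹ • ∫ s in dyadicIco k _, _ = _
  rw [volume_real_dyadicIco, one_div, inv_inv]
  congr 1
  refine setIntegral_congr_fun (measurableSet_dyadicIco _ _) fun s hs => ?_
  exact Set.indicator_of_mem (dyadicIco_subset (dyadicIndex_lt ht01.1.le ht01.2) hs) _

end DyadicIntervals

/-! ### Bounded dyadic martingales and the operators on `L¹` they define. -/

section DyadicMartingales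

variable {Z : Type*} [NormedAddCommGroup Z] [NormedSpace ℝ Z]

/-- The step function with value `e k i` on the `i`-th dyadic interval of order `k`. -/
def dyadicStep {S : Type*} (e : ℕ → ℕ → S) (k : ℕ) (t : ℝ) : S := e k (dyadicIndex k t)

/-- Families indexed by the dyadic tree in which each node is the mean of its two children. -/
def IsDyadicMartingale (e : ℕ → ℕ → Z) : Prop :=
  ∀ k i, e (k + 1) (2 * i) + e (k + 1) (2 * i + 1) = (2 : ℝ) • e k i

theorem stronglyMeasurable_dyadicStep {S : Type*} [TopologicalSpace S]
    [TopologicalSpace.PseudoMetrizableSpace S] (e : ℕ → ℕ → S) (k : ℕ) :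
    StronglyMeasurable (dyadicStep e k) :=
  (StronglyMeasurable.of_discrete (f := e k)).comp_measurable (measurable_dyadicIndex k)

theorem integrableOn_dyadicStep {S : Type*} [NormedAddCommGroup S] {e : ℕ → ℕ → S} {C : ℝ} (hC : ∀ k i, ‖e k i‖ ≤ C) (m k i : ℕ) :
    IntegrableOn (dyadicStep e m) (dyadicIco k i) :=
  have : IsFiniteMeasure (volume.restrict (dyadicIco k i)) :=
    ⟨by rw [Measure.restrict_apply_univ]; exact measure_Ico_lt_top⟩
  Integrable.of_bound (stronglyMeasurable_dyadicStep e m).aestronglyMeasurable C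
    (Eventually.of_forall fun _ => hC _ _)

theorem integrable_dyadicStep {S : Type*} [NormedAddCommGroup S] {e : ℕ → ℕ → S} {C : ℝ}
    (hC : ∀ k i, ‖e k i‖ ≤ C) (m : ℕ) : Integrable (dyadicStep e m) unitMeasure :=
  Integrable.of_bound (stronglyMeasurable_dyadicStep e m).aestronglyMeasurable C
    (Eventually.of_forall fun _ => hC _ _)

theorem setIntegral_dyadicStep_self [CompleteSpace Z] (e : ℕ → ℕ → Z) (k i : ℕ) :
    ∫ t in dyadicIco k i, dyadicStep e k t = (1 / 2 ^ k : ℝ) • e k i := by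
  rw [setIntegral_congr_fun (g := fun _ => e k i) (measurableSet_dyadicIco k i) fun t ht => by
    simp only [dyadicStep, dyadicIndex_eq_of_mem ht], setIntegral_const, volume_real_dyadicIco]

theorem IsDyadicMartingale.setIntegral [CompleteSpace Z] {e : ℕ → ℕ → Z}
    (he : IsDyadicMartingale e) {C : ℝ} (hC : ∀ k i, ‖e k i‖ ≤ C) {k m : ℕ} (hkm : k ≤ m) (i : ℕ) :
    ∫ t in dyadicIco k i, dyadicStep e m t = (1 / 2 ^ k : ℝ) • e k i := by
  obtain ⟨n, rfl⟩ := Nat.exists_eq_add_of_le hkm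
  clear hkm
  induction n generalizing k i with
  | zero => exact setIntegral_dyadicStep_self e k i
  | succ n ih =>
    rw [setIntegral_dyadicIco_split (integrableOn_dyadicStep hC _ _ _),
      show k + (n + 1) = k + 1 + n by ring, ih, ih, ← smul_add, he, smul_smul]
    congr 1
    rw [pow_succ]
    field_simp

/-- The submartingale inequality, iterated from level `k` to level `m`; it propagates the value of
the gauge at the root to the average over each level. -/
theorem le_setIntegral_dyadicStep {e : ℕ → ℕ → ℝ}
    (he : ∀ k i, 2 * e k i ≤ e (k + 1) (2 * i) + e (k + 1) (2 * i + 1))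
    {C : ℝ} (hC : ∀ k i, ‖e k i‖ ≤ C) {k m : ℕ} (hkm : k ≤ m) (i : ℕ) :
    1 / 2 ^ k * e k i ≤ ∫ t in dyadicIco k i, dyadicStep e m t := by
  obtain ⟨n, rfl⟩ := Nat.exists_eq_add_of_le hkm
  clear hkm
  induction n generalizing k i with
  | zero => exact (setIntegral_dyadicStep_self e k i).ge
  | succ n ih =>
    rw [setIntegral_dyadicIco_split (integrableOn_dyadicStep hC _ _ _),
      show k + (n + 1) = k + 1 + n by ring]
    refine le_trans ?_ (add_le_add (ih _) (ih _))
    rw [← mul_add]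
    refine le_trans (le_of_eq ?_) (mul_le_mul_of_nonneg_left (he k i) (by positivity))
    rw [pow_succ]
    field_simp

theorem norm_dyadic_average_le {f : ℝ → ℝ} {B : ℝ} (hB : ∀ᵐ t ∂unitMeasure, ‖f t‖ ≤ B)
    {k i : ℕ} (hi : i < 2 ^ k) : ‖(2 : ℝ) ^ k • ∫ s in dyadicIco k i, f s‖ ≤ B := by
  have h1 : ‖∫ s in dyadicIco k i, f s‖ ≤ B * volume.real (dyadicIco k i) := by
    refine norm_setIntegral_le_of_norm_le_const_ae measure_Ico_lt_top ?_
    have := ae_restrict_of_ae (s := dyadicIco k i) hB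
    rwa [unitMeasure_restrict_dyadicIco hi] at this
  rw [volume_real_dyadicIco] at h1
  rw [norm_smul, norm_pow, Real.norm_two]
  calc (2 : ℝ) ^ k * ‖∫ s in dyadicIco k i, f s‖ ≤ 2 ^ k * (B * (1 / 2 ^ k)) := by gcongr
    _ = B := by field_simp

/-- The operators `f ↦ ∫ f ξ k` for the step functions `ξ k` of a bounded dyadic family. -/
def dyadicOperator {e : ℕ → ℕ → Z} {C : ℝ} (hC : ∀ k i, ‖e k i‖ ≤ C) (k : ℕ) : L1 →L[ℝ] Z :=
  kernelOperator (μ := unitMeasure) (stronglyMeasurable_dyadicStep e k).aestronglyMeasurable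
    (Eventually.of_forall fun _ => hC _ _)

variable {e : ℕ → ℕ → Z} {C : ℝ} (hC : ∀ k i, ‖e k i‖ ≤ C)

theorem dyadicOperator_apply (k : ℕ) (f : L1) :
    dyadicOperator hC k f = ∫ t, f t • dyadicStep e k t ∂unitMeasure := rfl

theorem norm_dyadicOperator_apply_le (k : ℕ) (f : L1) : ‖dyadicOperator hC k f‖ ≤ C * ‖f‖ :=
  norm_kernelOperator_apply_le _ _ f

/-- The dyadic averages of `f` at level `k` are constant on intervals over which the two step
functions have equal integrals, so they contribute nothing and only the deviation of `f` from them
remains. -/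
theorem IsDyadicMartingale.norm_dyadicOperator_sub_le [CompleteSpace Z]
    (he : IsDyadicMartingale e) {f : L1} {B : ℝ} (hB : ∀ᵐ t ∂unitMeasure, ‖f t‖ ≤ B)
    {k m : ℕ} (hkm : k ≤ m) :
    ‖dyadicOperator hC m f - dyadicOperator hC k f‖ ≤
      2 * C * ∫ t, ‖f t - dyadicStep (fun k i => (2 : ℝ) ^ k • ∫ s in dyadicIco k i, f s) k t‖
        ∂unitMeasure := by
  set a : ℕ → ℕ → ℝ := fun k i => (2 : ℝ) ^ k • ∫ s in dyadicIco k i, f s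
  set d : ℝ → Z := fun t => dyadicStep e m t - dyadicStep e k t
  have hd : StronglyMeasurable d :=
    (stronglyMeasurable_dyadicStep e m).sub (stronglyMeasurable_dyadicStep e k)
  have hdC : ∀ t, ‖d t‖ ≤ 2 * C := fun t => by
    have := norm_sub_le (dyadicStep e m t) (dyadicStep e k t)
    have h1 : ‖dyadicStep e m t‖ ≤ C := hC _ _
    have h2 : ‖dyadicStep e k t‖ ≤ C := hC _ _
    linarith
  have ha : Integrable (dyadicStep a k) unitMeasure := by
    refine Integrable.of_bound (stronglyMeasurable_dyadicStep a k).aestronglyMeasurable B ?_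
    filter_upwards [ae_unitMeasure_mem] with t ht
    exact norm_dyadic_average_le hB (dyadicIndex_lt ht.1.le ht.2)
  have hfd : Integrable (fun t => f t • d t) unitMeasure :=
    (L1.integrable_coeFn f).smul_bdd (2 * C) hd.aestronglyMeasurable (Eventually.of_forall hdC)
  have had : Integrable (fun t => dyadicStep a k t • d t) unitMeasure :=
    ha.smul_bdd (2 * C) hd.aestronglyMeasurable (Eventually.of_forall hdC)
  have hzero : ∫ t, dyadicStep a k t • d t ∂unitMeasure = 0 := by
    rw [unitMeasure_eq] at had ⊢
    refine setIntegral_eq_zero_of_dyadic had (m := k) fun i hi => ?_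
    rw [setIntegral_congr_fun (g := fun t => a k i • d t) (measurableSet_dyadicIco k i)
      fun t ht => by simp only [dyadicStep, dyadicIndex_eq_of_mem ht], integral_smul,
      integral_sub (integrableOn_dyadicStep hC _ _ _) (integrableOn_dyadicStep hC _ _ _),
      he.setIntegral hC hkm, he.setIntegral hC le_rfl, sub_self, smul_zero]
  have hdiff : dyadicOperator hC m f - dyadicOperator hC k f =
      ∫ t, (f t - dyadicStep a k t) • d t ∂unitMeasure := by
    simp only [sub_smul]
    rw [integral_sub hfd had, hzero, sub_zero, dyadicOperator_apply, dyadicOperator_apply,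
      ← integral_sub (integrable_smul_of_bound
        (stronglyMeasurable_dyadicStep e m).aestronglyMeasurable
        (Eventually.of_forall fun _ => hC _ _) f) (integrable_smul_of_bound
        (stronglyMeasurable_dyadicStep e k).aestronglyMeasurable
        (Eventually.of_forall fun _ => hC _ _) f)]
    simp only [d, smul_sub]
  rw [hdiff]
  exact norm_integral_smul_le (Eventually.of_forall hdC) ((L1.integrable_coeFn f).sub ha)

theorem tendsto_integral_sub_dyadic_average {f : L1} {B : ℝ}
    (hB : ∀ᵐ t ∂unitMeasure, ‖f t‖ ≤ B) :
    Tendsto (fun k => ∫ t, ‖f t - dyadicStep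
      (fun k i => (2 : ℝ) ^ k • ∫ s in dyadicIco k i, f s) k t‖ ∂unitMeasure) atTop (𝓝 0) := by
  rw [← integral_zero ℝ ℝ (μ := unitMeasure)]
  refine tendsto_integral_of_dominated_convergence (fun _ => B + B) (fun k => ?_)
    (integrable_const _) (fun k => ?_) ?_
  · exact ((Lp.aestronglyMeasurable f).sub
      (stronglyMeasurable_dyadicStep _ k).aestronglyMeasurable).norm
  · filter_upwards [hB, ae_unitMeasure_mem] with t h1 h2
    rw [norm_norm]
    exact (norm_sub_le _ _).trans (add_le_add h1
      (norm_dyadic_average_le hB (dyadicIndex_lt h2.1.le h2.2)))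
  · filter_upwards [ae_tendsto_dyadic_average (L1.integrable_coeFn f)] with t ht
    have h1 := (tendsto_const_nhds (x := f t)).sub ht
    rw [sub_self] at h1
    simpa only [norm_zero, dyadicStep] using h1.norm

/-- An `ε / 3` argument from equiboundedness; it extends convergence from simple functions to all of
`L¹`. -/
theorem isClosed_setOf_cauchySeq {E : Type*} [NormedAddCommGroup E] [NormedSpace ℝ E]
    {S : ℕ → E →L[ℝ] Z} (hS : ∀ n x, ‖S n x‖ ≤ C * ‖x‖) :
    IsClosed {x | CauchySeq fun n => S n x} := by
  have hC' : ∀ n x, ‖S n x‖ ≤ (|C| + 1) * ‖x‖ := fun n x => (hS n x).trans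
    (mul_le_mul_of_nonneg_right (by linarith [le_abs_self C]) (norm_nonneg x))
  have hpos : 0 < |C| + 1 := by positivity
  refine isClosed_of_closure_subset fun x hx => ?_
  rw [Set.mem_ofPred_eq, Metric.cauchySeq_iff']
  intro ε hε
  obtain ⟨y, hy, hxy⟩ := Metric.mem_closure_iff.1 hx (ε / (3 * (|C| + 1))) (by positivity)
  obtain ⟨N, hN⟩ := Metric.cauchySeq_iff'.1 hy (ε / 3) (by positivity)
  refine ⟨N, fun n hn => ?_⟩
  have h1 : ∀ n, dist (S n x) (S n y) ≤ ε / 3 := fun n => by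
    rw [dist_eq_norm, ← map_sub]
    refine (hC' n _).trans ?_
    rw [← dist_eq_norm]
    refine (mul_le_mul_of_nonneg_left hxy.le hpos.le).trans (le_of_eq ?_)
    field_simp
  have h2 := dist_triangle4 (S n x) (S n y) (S N y) (S N x)
  have h3 := h1 N
  rw [dist_comm] at h3
  linarith [h1 n, hN n hn]

/-- A bounded dyadic martingale defines an operator on `L¹`. -/
theorem IsDyadicMartingale.exists_operator [CompleteSpace Z] (he : IsDyadicMartingale e) :
    ∃ D : L1 →L[ℝ] Z, ∀ f, Tendsto (fun m => dyadicOperator hC m f) atTop (𝓝 (D f)) := by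
  have hcau : ∀ f : L1, CauchySeq fun m => dyadicOperator hC m f := by
    intro f
    refine Lp.induction (p := 1) (by simp) (fun f : L1 => CauchySeq fun m => dyadicOperator hC m f)
      ?_ ?_ ?_ f
    · intro c s hs hμs
      set u : L1 := ((Lp.simpleFunc.indicatorConst 1 hs hμs.ne c :
        Lp.simpleFunc ℝ 1 unitMeasure) : Lp ℝ 1 unitMeasure)
      have hB : ∀ᵐ t ∂unitMeasure, ‖u t‖ ≤ ‖c‖ := by
        have hu : u =ᵐ[unitMeasure] s.indicator fun _ => c := by
          change (Lp.simpleFunc.indicatorConst 1 hs hμs.ne c : Lp ℝ 1 unitMeasure) =ᵐ[_] _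
          rw [Lp.simpleFunc.coe_indicatorConst]
          exact indicatorConstLp_coeFn
        filter_upwards [hu] with t ht
        rw [ht]
        exact norm_indicator_le_norm_self (fun _ => c) t
      rw [Metric.cauchySeq_iff']
      intro ε hε
      have h1 := (tendsto_integral_sub_dyadic_average hB).const_mul (2 * C)
      rw [mul_zero] at h1
      obtain ⟨N, hN⟩ := (h1.eventually_lt_const hε).exists
      refine ⟨N, fun n hn => ?_⟩
      rw [dist_eq_norm]
      exact (he.norm_dyadicOperator_sub_le hC hB hn).trans_lt hN
    · intro f g hf hg _ hcf hcg
      simp only [map_add]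
      exact hcf.add hcg
    · exact isClosed_setOf_cauchySeq (norm_dyadicOperator_apply_le hC)
  choose D hD using fun f => cauchySeq_tendsto_of_complete (hcau f)
  exact ⟨continuousLinearMapOfTendsto _ (tendsto_pi_nhds.2 hD), hD⟩

/-- By the martingale property the approximating values are constant once `m ≥ k`. Thus `D`
remembers the whole tree. -/
theorem IsDyadicMartingale.operator_indicator [CompleteSpace Z] (he : IsDyadicMartingale e)
    {D : L1 →L[ℝ] Z} (hD : ∀ f, Tendsto (fun m => dyadicOperator hC m f) atTop (𝓝 (D f)))
    {k i : ℕ} (hi : i < 2 ^ k) :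
    D (classL1 unitMeasure ((dyadicIco k i).indicator 1)) = (1 / 2 ^ k : ℝ) • e k i := by
  refine tendsto_nhds_unique (hD _) (tendsto_const_nhds.congr' ?_)
  filter_upwards [eventually_ge_atTop k] with m hm
  rw [← he.setIntegral hC hm, dyadicOperator_apply, ← unitMeasure_restrict_dyadicIco hi,
    ← integral_indicator (measurableSet_dyadicIco k i)]
  refine integral_congr_ae ?_
  filter_upwards [coeFn_classL1 (μ := unitMeasure) (f := (dyadicIco k i).indicator 1)
    ((integrable_const (1 : ℝ)).indicator (measurableSet_dyadicIco k i))] with t ht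
  rw [ht]
  by_cases h : t ∈ dyadicIco k i <;> simp [h]

/-- Representability of the operator of a dyadic martingale forces the increments to tend to
zero in mean. -/
theorem IsDyadicMartingale.tendsto_increments_of_isRepresentable [CompleteSpace Z]
    (he : IsDyadicMartingale e)
    {D : L1 →L[ℝ] Z} (hD : ∀ f, Tendsto (fun m => dyadicOperator hC m f) atTop (𝓝 (D f)))
    {X : Type*} [NormedAddCommGroup X] [NormedSpace ℝ X] [CompleteSpace X] {T : Z →L[ℝ] X}
    (hT : IsRepresentable (T.comp D)) :
    Tendsto (fun k => ∫ t, ‖T (dyadicStep e (k + 1) t) - T (dyadicStep e k t)‖ ∂unitMeasure)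
      atTop (𝓝 0) := by
  obtain ⟨g, hg⟩ := hT
  have hgi : Integrable g unitMeasure := (Lp.memLp g).integrable le_top
  -- The average of `g` over the dyadic interval containing `t` is `T` of the node there, so
  -- differentiation gives convergence almost everywhere.
  have hlim : ∀ᵐ t ∂unitMeasure,
      Tendsto (fun k => T (dyadicStep e k t)) atTop (𝓝 (g t)) := by
    filter_upwards [ae_tendsto_dyadic_average hgi, ae_unitMeasure_mem] with t ht ht01
    refine ht.congr fun k => ?_
    have hi : dyadicIndex k t < 2 ^ k := dyadicIndex_lt ht01.1.le ht01.2
    have h1 := hg (classL1 unitMeasure ((dyadicIco k (dyadicIndex k t)).indicator 1))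
    rw [ContinuousLinearMap.comp_apply, he.operator_indicator hC hD hi, map_smul] at h1
    have h2 : ∫ s, (classL1 unitMeasure ((dyadicIco k (dyadicIndex k t)).indicator 1)) s • g s
        ∂unitMeasure = ∫ s in dyadicIco k (dyadicIndex k t), g s := by
      rw [← unitMeasure_restrict_dyadicIco hi, ← integral_indicator (measurableSet_dyadicIco _ _)]
      refine integral_congr_ae ?_
      filter_upwards [coeFn_classL1 (μ := unitMeasure)
        (f := (dyadicIco k (dyadicIndex k t)).indicator 1)
        ((integrable_const (1 : ℝ)).indicator (measurableSet_dyadicIco _ _))] with s hs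
      rw [hs]
      by_cases h : s ∈ dyadicIco k (dyadicIndex k t) <;> simp [h]
    rw [← h2, ← h1, smul_smul, mul_one_div_cancel (by positivity), one_smul, dyadicStep]
  rw [← integral_zero ℝ ℝ (μ := unitMeasure)]
  have hm : ∀ k, StronglyMeasurable fun t => T (dyadicStep e k t) := fun k =>
    T.continuous.comp_stronglyMeasurable (stronglyMeasurable_dyadicStep e k)
  refine tendsto_integral_of_dominated_convergence (fun _ => ‖T‖ * C + ‖T‖ * C)
    (fun k => ((hm _).sub (hm _)).norm.aestronglyMeasurable) (integrable_const _)
    (fun k => Eventually.of_forall fun t => ?_) ?_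
  · rw [norm_norm]
    exact (norm_sub_le _ _).trans (add_le_add (T.le_opNorm_of_le (hC _ _))
      (T.le_opNorm_of_le (hC _ _)))
  · filter_upwards [hlim] with t ht
    have h1 := ((tendsto_add_atTop_iff_nat 1).2 ht).sub ht
    rw [sub_self] at h1
    simpa only [norm_zero] using h1.norm

/-- The operator of a dyadic martingale composed with `R` is representable when the increments of
the image under `R` are summable. -/
theorem isRepresentable_of_increments_le [CompleteSpace Z]
    {D : L1 →L[ℝ] Z} (hD : ∀ f, Tendsto (fun m => dyadicOperator hC m f) atTop (𝓝 (D f)))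
    {Y : Type*} [NormedAddCommGroup Y] [NormedSpace ℝ Y] [CompleteSpace Y] {R : Z →L[ℝ] Y}
    {n : ℕ} (hR : ∀ k ≥ n, ∀ j, ‖R (e (k + 1) j - e k (j / 2))‖ ≤ (1 / 2) ^ k) :
    IsRepresentable (R.comp D) := by
  have hm : ∀ k, StronglyMeasurable fun t => R (dyadicStep e k t) := fun k =>
    R.continuous.comp_stronglyMeasurable (stronglyMeasurable_dyadicStep e k)
  have hb : ∀ k t, ‖R (dyadicStep e k t)‖ ≤ ‖R‖ * C := fun k t => R.le_opNorm_of_le (hC _ _)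
  have hcau : ∀ t, ∃ y, Tendsto (fun k => R (dyadicStep e k t)) atTop (𝓝 y) := by
    intro t
    -- The increments are controlled only from level `n` on, hence the shift.
    have h1 : CauchySeq fun k => R (dyadicStep e (k + n) t) := by
      refine cauchySeq_of_le_geometric (1 / 2) 1 (by norm_num) fun k => ?_
      have h2 := hR (k + n) (by omega) (dyadicIndex (k + n + 1) t)
      rw [dyadicIndex_succ_div_two] at h2
      rw [dist_comm, dist_eq_norm, ← map_sub, show k + 1 + n = k + n + 1 by ring, one_mul]
      exact h2.trans (pow_le_pow_of_le_one (by norm_num) (by norm_num) (by omega))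
    obtain ⟨y, hy⟩ := cauchySeq_tendsto_of_complete h1
    exact ⟨y, (tendsto_add_atTop_iff_nat (f := fun k => R (dyadicStep e k t)) n).1 hy⟩
  choose g hg using hcau
  have hgm : StronglyMeasurable g := stronglyMeasurable_of_tendsto atTop hm (tendsto_pi_nhds.2 hg)
  have hgb : ∀ t, ‖g t‖ ≤ ‖R‖ * C := fun t =>
    le_of_tendsto (hg t).norm (Eventually.of_forall fun k => hb k t)
  have hgL : MemLp g ∞ unitMeasure :=
    memLp_top_of_bound hgm.aestronglyMeasurable _ (Eventually.of_forall hgb)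
  refine ⟨hgL.toLp g, fun f => ?_⟩
  have h1 : Tendsto (fun m => ∫ t, f t • R (dyadicStep e m t) ∂unitMeasure) atTop
      (𝓝 (∫ t, f t • g t ∂unitMeasure)) := by
    refine tendsto_integral_of_dominated_convergence (fun t => ‖f t‖ * (‖R‖ * C))
      (fun m => (Lp.aestronglyMeasurable f).smul (hm m).aestronglyMeasurable)
      ((L1.integrable_coeFn f).norm.mul_const _)
      (fun m => Eventually.of_forall fun t => ?_)
      (Eventually.of_forall fun t => (hg t).const_smul (f t))
    rw [norm_smul]
    exact mul_le_mul_of_nonneg_left (hb m t) (norm_nonneg _)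
  have h2 : ∫ t, f t • hgL.toLp g t ∂unitMeasure = ∫ t, f t • g t ∂unitMeasure := by
    refine integral_congr_ae ?_
    filter_upwards [hgL.coeFn_toLp] with t ht
    rw [ht]
  rw [h2]
  refine tendsto_nhds_unique ((R.continuous.tendsto _).comp (hD f)) (h1.congr fun m => ?_)
  rw [Function.comp_apply, dyadicOperator_apply, ← ContinuousLinearMap.integral_comp_comm R
    (integrable_smul_of_bound (stronglyMeasurable_dyadicStep e m).aestronglyMeasurable
      (Eventually.of_forall fun _ => hC _ _) f)]
  simp only [map_smul]

end DyadicMartingales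

/-! ### The gauge and the tree of densities. -/

section Tree

/-- Bounded nonnegative measurable functions. -/
structure IsBoundedDensity {α : Type*} [MeasurableSpace α] (ξ : α → ℝ) : Prop where
  measurable : Measurable ξ
  nonneg : ∀ t, 0 ≤ ξ t
  exists_le : ∃ C, ∀ t, ξ t ≤ C

namespace IsBoundedDensity

variable {α : Type*} [MeasurableSpace α] {μ : Measure α} {ξ h : α → ℝ}

theorem one : IsBoundedDensity fun _ : α => (1 : ℝ) :=
  ⟨measurable_const, fun _ => zero_le_one, 1, fun _ => le_rfl⟩

theorem exists_norm_mul_le (hξ : IsBoundedDensity ξ) :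
    ∃ C, ∀ h : α → ℝ, (∀ t, ‖h t‖ ≤ 1) → ∀ t, ‖ξ t * h t‖ ≤ C := by
  obtain ⟨C, hC⟩ := hξ.exists_le
  refine ⟨C, fun h hh t => ?_⟩
  rw [norm_mul, Real.norm_of_nonneg (hξ.nonneg t)]
  exact (mul_le_of_le_one_right (hξ.nonneg t) (hh t)).trans (hC t)

theorem mul_one_add (hξ : IsBoundedDensity ξ) (hm : Measurable h) (hh : ∀ t, ‖h t‖ ≤ 1) :
    IsBoundedDensity fun t => ξ t * (1 + h t) := by
  obtain ⟨C, hC⟩ := hξ.exists_le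
  have h1 : ∀ t, 0 ≤ 1 + h t ∧ 1 + h t ≤ 2 := fun t => by
    have := abs_le.1 (hh t)
    constructor <;> linarith
  refine ⟨hξ.measurable.mul (measurable_const.add hm),
    fun t => mul_nonneg (hξ.nonneg t) (h1 t).1, C * 2, fun t => ?_⟩
  exact mul_le_mul (hC t) (h1 t).2 (h1 t).1 ((hξ.nonneg t).trans (hC t))

variable [IsFiniteMeasure μ]

theorem integrable (hξ : IsBoundedDensity ξ) : Integrable ξ μ := by
  obtain ⟨C, hC⟩ := hξ.exists_le
  exact integrable_of_measurable_bound hξ.measurable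
    fun t => (Real.norm_of_nonneg (hξ.nonneg t)).trans_le (hC t)

theorem integrable_mul (hξ : IsBoundedDensity ξ) (hm : Measurable h) (hh : ∀ t, ‖h t‖ ≤ 1) :
    Integrable (fun t => ξ t * h t) μ := by
  obtain ⟨C, hC⟩ := hξ.exists_norm_mul_le
  exact integrable_of_measurable_bound (hξ.measurable.mul hm) (hC h hh)

theorem norm_classL1_eq (hξ : IsBoundedDensity ξ) : ‖classL1 μ ξ‖ = ∫ t, ξ t ∂μ := by
  rw [norm_classL1 hξ.integrable]
  simp only [Real.norm_of_nonneg (hξ.nonneg _)]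

end IsBoundedDensity

/-- For a non-Dunford-Pettis operator `T` there is a sublinear gauge `φ` of the size of `T` on
oscillating perturbations of a density; the perturbations may be taken almost invisible to
finitely many Dunford-Pettis operators. -/
theorem exists_gauge_of_not_isDunfordPettis {α : Type*} [MeasurableSpace α] {μ : Measure α}
    [IsFiniteMeasure μ] [TopologicalSpace.SeparableSpace (Lp ℝ 1 μ)]
    {X : Type*} [NormedAddCommGroup X] [NormedSpace ℝ X] [CompleteSpace X]
    {Y : ℕ → Type*} [∀ n, NormedAddCommGroup (Y n)] [∀ n, NormedSpace ℝ (Y n)]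
    {T : Lp ℝ 1 μ →L[ℝ] X} (hT : ¬ IsDunfordPettis T)
    {R : ∀ n, Lp ℝ 1 μ →L[ℝ] Y n} (hR : ∀ n, IsDunfordPettis (R n)) :
    ∃ φ : (α → ℝ) → ℝ, 0 < φ (fun _ => 1) ∧
      (∀ ξ η, IsBoundedDensity ξ → IsBoundedDensity η →
        2 * φ (fun t => (ξ t + η t) / 2) ≤ φ ξ + φ η) ∧
      (∀ ξ, IsBoundedDensity ξ → ‖φ ξ‖ ≤ ‖T‖ * ∫ t, ξ t ∂μ) ∧
      ∀ (k : ℕ) ξ, IsBoundedDensity ξ → ∃ h : α → ℝ, Measurable h ∧ (∀ t, ‖h t‖ ≤ 1) ∧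
        |∫ t, ξ t * h t ∂μ| ≤ (1 / 2) ^ k ∧
        (∀ j ≤ k, ‖R j (classL1 μ fun t => ξ t * h t)‖ ≤ (1 / 2) ^ k) ∧
        φ ξ - (1 / 2) ^ k ≤ ‖T (classL1 μ fun t => ξ t * h t)‖ := by
  obtain ⟨V, g, hgm, hg1, hnull, δ, hδ, hV⟩ :=
    exists_bounded_weakly_null_of_not_isDunfordPettis hT
  have hbound : ∀ ξ, IsBoundedDensity ξ → ∀ i,
      ‖T (classL1 μ fun t => ξ t * g i t)‖ ≤ ‖T‖ * ∫ t, ξ t ∂μ := fun ξ hξ i => by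
    refine T.le_opNorm_of_le ?_
    rw [norm_classL1 (hξ.integrable_mul (hgm i) (hg1 i))]
    refine integral_mono (hξ.integrable_mul (hgm i) (hg1 i)).norm hξ.integrable fun t => ?_
    simp only [norm_mul, Real.norm_of_nonneg (hξ.nonneg _)]
    exact mul_le_of_le_one_right (hξ.nonneg t) (hg1 i t)
  -- The ultrafilter provides limits for all densities at once; the value `0` elsewhere only makes
  -- `φ` total.
  have hex : ∀ ξ : α → ℝ, ∃ l : ℝ, IsBoundedDensity ξ →
      Tendsto (fun i => ‖T (classL1 μ fun t => ξ t * g i t)‖) V (𝓝 l) := fun ξ => by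
    by_cases hξ : IsBoundedDensity ξ
    · obtain ⟨l, hl⟩ := ultrafilter_exists_tendsto_of_bound V
        (F := fun i => ‖T (classL1 μ fun t => ξ t * g i t)‖)
        (fun i => (abs_norm _).trans_le (hbound ξ hξ i))
      exact ⟨l, fun _ => hl⟩
    · exact ⟨0, fun h => absurd h hξ⟩
  choose φ hφ using hex
  refine ⟨φ, ?_, fun ξ η hξ hη => ?_, fun ξ hξ => ?_, fun k ξ hξ => ?_⟩
  · refine hδ.trans_le (ge_of_tendsto (hφ _ IsBoundedDensity.one) ?_)
    simpa only [one_mul] using hV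
  · have hmean : IsBoundedDensity fun t => (ξ t + η t) / 2 := by
      obtain ⟨C, hC⟩ := hξ.exists_le
      obtain ⟨B, hB⟩ := hη.exists_le
      refine ⟨(hξ.measurable.add hη.measurable).div_const 2,
        fun t => by linarith [hξ.nonneg t, hη.nonneg t], (C + B) / 2,
        fun t => by linarith [hC t, hB t]⟩
    refine le_of_tendsto_of_tendsto' ((hφ _ hmean).const_mul 2) ((hφ _ hξ).add (hφ _ hη))
      fun i => ?_
    have hi := hmean.integrable_mul (μ := μ) (hgm i) (hg1 i)
    have h1 : classL1 μ (fun t => ξ t * g i t) + classL1 μ (fun t => η t * g i t) =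
        classL1 μ (fun t => (ξ t + η t) / 2 * g i t) +
          classL1 μ (fun t => (ξ t + η t) / 2 * g i t) := by
      rw [← classL1_add (hξ.integrable_mul (hgm i) (hg1 i))
        (hη.integrable_mul (hgm i) (hg1 i)), ← classL1_add hi hi]
      congr 1
      ext t
      ring
    have h2 := norm_add_le (T (classL1 μ fun t => ξ t * g i t))
      (T (classL1 μ fun t => η t * g i t))
    rw [← map_add, h1, map_add, ← two_smul ℝ, norm_smul, Real.norm_two] at h2
    exact h2
  · refine le_of_tendsto (hφ ξ hξ).norm (Eventually.of_forall fun i => ?_)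
    rw [norm_norm]
    exact hbound ξ hξ i
  · have hpos : (0 : ℝ) < (1 / 2) ^ k := by positivity
    obtain ⟨C, hC⟩ := hξ.exists_norm_mul_le
    -- Multiplying by the bounded `ξ` preserves weak nullity, since `q * ξ` is integrable. Each
    -- requirement on `h` then holds eventually along `V`, and there are finitely many.
    have hnullξ : ∀ q, Integrable q μ →
        Tendsto (fun i => ∫ t, q t * (ξ t * g i t) ∂μ) V (𝓝 0) := fun q hq => by
      obtain ⟨B, hB⟩ := hξ.exists_le
      have h1 := hnull (fun t => q t * ξ t) (hq.mul_bdd hξ.measurable.aestronglyMeasurable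
        (Eventually.of_forall fun t => (Real.norm_of_nonneg (hξ.nonneg t)).trans_le (hB t)))
      simpa only [mul_assoc] using h1
    have e1 : ∀ᶠ i in V, |∫ t, ξ t * g i t ∂μ| ≤ (1 / 2) ^ k := by
      have h1 := (hnull ξ hξ.integrable).abs
      rw [abs_zero] at h1
      exact h1.eventually_le_const hpos
    have e2 : ∀ᶠ i in V, ∀ j ∈ Set.Iic k,
        ‖R j (classL1 μ fun t => ξ t * g i t)‖ ≤ (1 / 2) ^ k := by
      refine (eventually_all_finite (Set.finite_Iic k)).2 fun j _ => ?_
      have h1 := ((hR j).tendsto_classL1 V (fun i => hξ.measurable.mul (hgm i))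
        (fun i => hC (g i) (hg1 i)) hnullξ).norm
      rw [norm_zero] at h1
      exact h1.eventually_le_const hpos
    have e3 := (hφ ξ hξ).eventually_const_le (sub_lt_self (φ ξ) hpos)
    obtain ⟨i, h1, h2, h3⟩ := (e1.and (e2.and e3)).exists
    exact ⟨g i, hgm i, hg1 i, h1, h2, h3⟩

/-- The tree of densities in which the children of `ξ` at level `k` are `ξ (1 ± c k ξ)`. -/
def densityTree {α : Type*} (c : ℕ → (α → ℝ) → α → ℝ) : ℕ → ℕ → α → ℝ
  | 0, _ => fun _ => 1
  | k + 1, j => fun t => densityTree c k (j / 2) t *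
      (1 + (if j % 2 = 0 then 1 else -1) * c k (densityTree c k (j / 2)) t)

variable {α : Type*} {c : ℕ → (α → ℝ) → α → ℝ}

theorem densityTree_even (k i : ℕ) : densityTree c (k + 1) (2 * i) =
    fun t => densityTree c k i t * (1 + c k (densityTree c k i) t) := by
  ext t
  simp [densityTree]

theorem densityTree_odd (k i : ℕ) : densityTree c (k + 1) (2 * i + 1) =
    fun t => densityTree c k i t * (1 + -c k (densityTree c k i) t) := by
  ext t
  have h1 : (2 * i + 1) / 2 = i := by omega
  have h2 : (2 * i + 1) % 2 = 1 := by omega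
  simp [densityTree, h1, h2]

theorem densityTree_succ (k j : ℕ) : ∃ s : ℝ, |s| = 1 ∧ densityTree c (k + 1) j =
    fun t => densityTree c k (j / 2) t +
      s * (densityTree c k (j / 2) t * c k (densityTree c k (j / 2)) t) := by
  refine ⟨if j % 2 = 0 then 1 else -1, by split_ifs <;> simp, ?_⟩
  ext t
  rw [densityTree]
  ring

variable [MeasurableSpace α] {μ : Measure α}

theorem isBoundedDensity_densityTree
    (hc : ∀ k ξ, IsBoundedDensity ξ → Measurable (c k ξ) ∧ ∀ t, ‖c k ξ t‖ ≤ 1) (k i : ℕ) :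
    IsBoundedDensity (densityTree c k i) := by
  induction k generalizing i with
  | zero => exact IsBoundedDensity.one
  | succ k ih =>
    obtain ⟨h1, h2⟩ := hc k _ (ih (i / 2))
    rcases Nat.even_or_odd' i with ⟨j, rfl | rfl⟩
    · rw [densityTree_even]
      obtain ⟨h1, h2⟩ := hc k _ (ih j)
      exact (ih j).mul_one_add h1 h2
    · rw [densityTree_odd]
      obtain ⟨h1, h2⟩ := hc k _ (ih j)
      exact (ih j).mul_one_add h1.neg (fun t => (norm_neg _).trans_le (h2 t))

theorem classL1_densityTree_succ [IsFiniteMeasure μ]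
    (hc : ∀ k ξ, IsBoundedDensity ξ → Measurable (c k ξ) ∧ ∀ t, ‖c k ξ t‖ ≤ 1) (k j : ℕ) :
    ∃ s : ℝ, |s| = 1 ∧ classL1 μ (densityTree c (k + 1) j) -
      classL1 μ (densityTree c k (j / 2)) = s • classL1 μ fun t =>
        densityTree c k (j / 2) t * c k (densityTree c k (j / 2)) t := by
  obtain ⟨s, hs, hsucc⟩ := densityTree_succ (c := c) k j
  have hξ := isBoundedDensity_densityTree hc k (j / 2)
  have hi := hξ.integrable_mul (μ := μ) (hc k _ hξ).1 (hc k _ hξ).2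
  refine ⟨s, hs, ?_⟩
  rw [hsucc, classL1_add hξ.integrable (hi.const_mul s), add_sub_cancel_left,
    classL1_of_integrable (hi.const_mul s), classL1_of_integrable hi, ← Integrable.toL1_smul]
  rfl

theorem isDyadicMartingale_densityTree [IsFiniteMeasure μ]
    (hc : ∀ k ξ, IsBoundedDensity ξ → Measurable (c k ξ) ∧ ∀ t, ‖c k ξ t‖ ≤ 1) :
    IsDyadicMartingale fun k i => classL1 μ (densityTree c k i) := by
  intro k i
  have hd := fun k i => (isBoundedDensity_densityTree hc k i).integrable (μ := μ)
  rw [two_smul, ← classL1_add (hd _ _) (hd _ _), ← classL1_add (hd _ _) (hd _ _),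
    densityTree_even, densityTree_odd]
  congr 1
  ext t
  ring

/-- The root has integral `1` and passing from level `k` to `k + 1` adds at most `2⁻ᵏ`; the bound is
the sum of this geometric series, so it stays below `3`. -/
theorem integral_densityTree_le [IsProbabilityMeasure μ]
    (hc : ∀ k ξ, IsBoundedDensity ξ → Measurable (c k ξ) ∧ ∀ t, ‖c k ξ t‖ ≤ 1)
    (hc' : ∀ k ξ, IsBoundedDensity ξ → |∫ t, ξ t * c k ξ t ∂μ| ≤ (1 / 2) ^ k) (k i : ℕ) :
    ∫ t, densityTree c k i t ∂μ ≤ 3 - 2 * (1 / 2) ^ k := by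
  induction k generalizing i with
  | zero => simp [densityTree]; norm_num
  | succ k ih =>
    obtain ⟨s, hs, hsucc⟩ := densityTree_succ (c := c) k i
    have hξ := isBoundedDensity_densityTree hc k (i / 2)
    have hi := hξ.integrable_mul (μ := μ) (hc k _ hξ).1 (hc k _ hξ).2
    rw [hsucc, integral_add hξ.integrable (hi.const_mul s), integral_const_mul]
    have h1 := le_abs_self
      (s * ∫ t, densityTree c k (i / 2) t * c k (densityTree c k (i / 2)) t ∂μ)
    rw [abs_mul, hs, one_mul] at h1
    have h2 := hc' k _ hξ
    have h3 := ih (i / 2)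
    rw [pow_succ]
    linarith

end Tree

/-! ### Construction of the operator. -/

instance isProbabilityMeasure_unitMeasure : IsProbabilityMeasure unitMeasure :=
  ⟨by simp [unitMeasure]⟩

/-- If `T` is not Dunford-Pettis while every `R n` is, some operator `D` on `L¹(0,1)` makes every
`R n ∘ D` representable but not `T ∘ D`. -/
theorem exists_operator_not_isRepresentable_comp
    {X : Type*} [NormedAddCommGroup X] [NormedSpace ℝ X] [CompleteSpace X]
    {Y : ℕ → Type*} [∀ n, NormedAddCommGroup (Y n)] [∀ n, NormedSpace ℝ (Y n)]
    [∀ n, CompleteSpace (Y n)] {T : L1 →L[ℝ] X} (hT : ¬ IsDunfordPettis T)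
    {R : ∀ n, L1 →L[ℝ] Y n} (hR : ∀ n, IsDunfordPettis (R n)) :
    ∃ D : L1 →L[ℝ] L1, ¬ IsRepresentable (T.comp D) ∧ ∀ n, IsRepresentable ((R n).comp D) := by
  -- Finiteness of the exponent gives separability of `L¹`.
  have : Fact ((1 : ℝ≥0∞) ≠ ∞) := ⟨ENNReal.one_ne_top⟩
  obtain ⟨φ, hφ1, hφmean, hφle, hstep⟩ := exists_gauge_of_not_isDunfordPettis hT hR
  choose! c hcm hc1 hcint hcR hcT using hstep
  have hc : ∀ k ξ, IsBoundedDensity ξ → Measurable (c k ξ) ∧ ∀ t, ‖c k ξ t‖ ≤ 1 :=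
    fun k ξ hξ => ⟨hcm k ξ hξ, hc1 k ξ hξ⟩
  set ξ := densityTree c
  have hξ : ∀ k i, IsBoundedDensity (ξ k i) := isBoundedDensity_densityTree hc
  have hint : ∀ k i, ∫ t, ξ k i t ∂unitMeasure ≤ 3 := fun k i => by
    have h1 := integral_densityTree_le (μ := unitMeasure) hc hcint k i
    have h2 : (0 : ℝ) < (1 / 2) ^ k := by positivity
    linarith
  set e : ℕ → ℕ → L1 := fun k i => classL1 unitMeasure (ξ k i)
  have hC : ∀ k i, ‖e k i‖ ≤ 3 := fun k i => (hξ k i).norm_classL1_eq.trans_le (hint k i)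
  have he : IsDyadicMartingale e := isDyadicMartingale_densityTree hc
  obtain ⟨D, hD⟩ := he.exists_operator hC
  refine ⟨D, fun hrep => ?_, fun n => ?_⟩
  · have hlim := he.tendsto_increments_of_isRepresentable hC hD hrep
    have hφC : ∀ k i, ‖φ (ξ k i)‖ ≤ ‖T‖ * 3 := fun k i => (hφle _ (hξ k i)).trans
      (mul_le_mul_of_nonneg_left (hint k i) (norm_nonneg T))
    -- Pointwise the increment of `T` at a node `ξ` has norm at least `φ ξ - 2⁻ᵏ`, and the mean of
    -- `φ` over level `k` is at least its value at the root.
    have hlow : ∀ k, φ (fun _ => 1) - (1 / 2) ^ k ≤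
        ∫ t, ‖T (dyadicStep e (k + 1) t) - T (dyadicStep e k t)‖ ∂unitMeasure := by
      intro k
      have h1 := le_setIntegral_dyadicStep (e := fun k i => φ (ξ k i)) (fun k i => by
        have h2 := hφmean _ _ (hξ (k + 1) (2 * i)) (hξ (k + 1) (2 * i + 1))
        have h3 : (fun t => (ξ (k + 1) (2 * i) t + ξ (k + 1) (2 * i + 1) t) / 2) = ξ k i := by
          simp only [ξ, densityTree_even, densityTree_odd]
          ext t
          ring
        rwa [h3] at h2) hφC (Nat.zero_le k) 0
      rw [pow_zero, div_one, one_mul, ← unitMeasure_eq] at h1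
      have hφi : Integrable (dyadicStep (fun k i => φ (ξ k i)) k) unitMeasure :=
        integrable_dyadicStep hφC k
      have hTm : ∀ k, Integrable (fun t => T (dyadicStep e k t)) unitMeasure := fun k =>
        T.integrable_comp (integrable_dyadicStep hC k)
      refine (sub_le_sub_right h1 _).trans ?_
      have h4 : ∫ t, (dyadicStep (fun k i => φ (ξ k i)) k t - (1 / 2) ^ k) ∂unitMeasure =
          ∫ t, dyadicStep (fun k i => φ (ξ k i)) k t ∂unitMeasure - (1 / 2) ^ k := by
        rw [integral_sub hφi (integrable_const _)]
        simp
      rw [← h4]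
      refine integral_mono (hφi.sub (integrable_const _)) ((hTm _).sub (hTm _)).norm fun t => ?_
      obtain ⟨s, hs, hinc⟩ := classL1_densityTree_succ (μ := unitMeasure) hc k
        (dyadicIndex (k + 1) t)
      rw [dyadicIndex_succ_div_two] at hinc
      have h5 : T (dyadicStep e (k + 1) t) - T (dyadicStep e k t) = s • T (classL1 unitMeasure
          fun u => ξ k (dyadicIndex k t) u * c k (ξ k (dyadicIndex k t)) u) := by
        rw [← map_sub, ← map_smul, ← hinc]
        rfl
      simp only [h5, norm_smul, Real.norm_eq_abs, hs, one_mul]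
      exact hcT k _ (hξ k _)
    have hlim0 : Tendsto (fun k : ℕ => φ (fun _ => 1) - (1 / 2 : ℝ) ^ k) atTop
        (𝓝 (φ (fun _ => 1) - 0)) := tendsto_const_nhds.sub
      (tendsto_pow_atTop_nhds_zero_of_lt_one (by norm_num) (by norm_num))
    rw [sub_zero] at hlim0
    exact absurd (le_of_tendsto_of_tendsto' hlim0 hlim hlow) (not_le.2 hφ1)
  -- The perturbation at level `k` is small for `R 0, …, R k`, so `R n` is controlled at all levels
  -- `k ≥ n`.
  · refine isRepresentable_of_increments_le hC hD (n := n) fun k hk j => ?_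
    obtain ⟨s, hs, hinc⟩ := classL1_densityTree_succ (μ := unitMeasure) hc k j
    rw [hinc, map_smul, norm_smul, Real.norm_eq_abs, hs, one_mul]
    exact hcR k _ (hξ k _) n hk

end

theorem proposition1p2 {X : Type*} [NormedAddCommGroup X] [NormedSpace ℝ X] [CompleteSpace X]
    {Y : ℕ → Type*} [∀ n, NormedAddCommGroup (Y n)] [∀ n, NormedSpace ℝ (Y n)]
    [∀ n, CompleteSpace (Y n)]
    (J : ∀ n, Y n →L[ℝ] X) (hJ : IsSchauderDecomposition J)
    (T : L1 →L[ℝ] X) (hT : ¬ IsDunfordPettis T)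
    (hPT : ∀ n, IsDunfordPettis ((hJ.proj n).comp T)) :
    ∃ D : L1 →L[ℝ] L1, ¬ IsRepresentable (T.comp D) ∧
      ∀ n, IsRepresentable (((hJ.proj n).comp T).comp D) := by
  exact exists_operator_not_isRepresentable_comp hT hPT
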